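/- Let $t\ge 1$ and $m_1,\dots,m_t\ge 1$, and put $m=m_1+\dots+m_t$. For each $s$ let $\Delta_s\subset\mathbb{R}^{m_s}$ be a full-dimensional simplex, let $P=\Delta_1\times\dots\times\Delta_t\subset\mathbb{R}^{m}$, and let $c=(c_1,\dots,c_t)\in\mathbb{R}^{m}$ be generic, i.e. $\langle c,u\rangle\neq\langle c,v\rangle$ for every edge $uv$ of $P$. For a polytope $Q\subset\mathbb{R}^d$ and a generic direction $c\in\mathbb{R}^d$, an improving neighbor of a vertex $u$ is a vertex $v$ such that $uv$ is an edge of $Q$ and $\langle c,u\rangle<\langle c,v\rangle$. For $\omega\in\mathbb{R}^d$ let $\rho^\omega(u,v)=\langle\omega,v-u\rangle/\langle c,v-u\rangle$, and for a vertex $u$ that does not maximize $c$ let $\tau^\omega(u)$ be the maximum of $\rho^\omega(u,v)$ over the improving neighbors $v$ of $u$. If this maximum is attained at a unique $v$ for each such $u$, then $\omega$ is called generic, and its arborescence is the map $A^\omega$ sending each such $u$ to this $v$ and fixing the $c$-maximal vertex. The pivot fan of $(Q,c)$ is the fan whose maximal cones are the closures of the nonempty fibers of $\omega\mapsto A^\omega$.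 Let $u_{s,1},\dots,u_{s,m_s+1}$ be the vertices of $\Delta_s$ in increasing order of $\langle c_s,\cdot\rangle$. The product slope map $\Theta:\mathbb{R}^m\to\mathbb{R}^m$ sends $\omega=(\omega_1,\dots,\omega_t)$ to the concatenation, for $s=1,\dots,t$, of the vectors $(\tau^{\omega_s}(u_{s,i}))_{1\le i\le m_s}$ computed in $(\Delta_s,c_s)$. The normal fan of a polytope is the collection of outer normal cones of its nonempty faces. Let $\mathrm{Perm}(n)\subset\mathbb{R}^n$ be the convex hull of all permutations of $(1,\dots,n)$, and let $\mathrm{Asso}(n)=\sum_{1\le i<k\le n}\mathrm{conv}\{-e_j: i\le j\le k\}\subset\mathbb{R}^n$ be the $n$-associahedron (the opposite of Loday's). For $Q\subset\mathbb{R}^a$ and $R\subset\mathbb{R}^b$, the shuffle is $Q\star R=(Q\times R)+\sum_{i=1}^{a}\sum_{j=1}^{b}[e_i,e_{a+j}]\subset\mathbb{R}^{a+b}$. The $(a,b)$-constrainahedron is $\mathrm{Asso}(a)\star\mathrm{Asso}(b)$ and the $(a,b)$-multiplihedron is $\mathrm{Perm}(a)\star\mathrm{Asso}(b)$. Then $\Theta$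 is a piecewise linear isomorphism from the pivot fan of $(P,c)$ (that is, a homeomorphism that is linear on each cone of this fan and maps its cones onto the cones of the target fan) to the normal fan of - the $t$-permutahedron $\mathrm{Perm}(t)$, when $m_1=\dots=m_t=1$; - the $m_1$-associahedron $\mathrm{Asso}(m_1)$, when $t=1$; - the $(m_1,m_2)$-constrainahedron, when $t=2$; - the $(t-1,m_t)$-multiplihedron, when $m_1=\dots=m_{t-1}=1$. -/

import Mathlib

open scoped Pointwise

noncomputable section

/-! ### Linear programs, improving neighbors, slopes

All polytopes live in a coordinate space `ι → ℝ`, with the standard scalar product `⬝ᵥ`. -/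

section LinearProgram

variable {ι : Type} [Fintype ι]

/-- `u` and `v` are distinct and the segment `[u, v]` is a face of `P`. -/
def IsEdge (P : Set (ι → ℝ)) (u v : ι → ℝ) : Prop :=
  u ≠ v ∧ IsExposed ℝ P (segment ℝ u v)

/-- The linear program `(P, c)` is generic: the endpoints of any edge have distinct values. -/
def IsGenericDirection (P : Set (ι → ℝ)) (c : ι → ℝ) : Prop :=
  ∀ u v, IsEdge P u v → c ⬝ᵥ u ≠ c ⬝ᵥ v

/-- The improving neighbors of `u`. -/
def improvingNeighbors (P : Set (ι → ℝ)) (c u : ι → ℝ) : Set (ι → ℝ) :=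
  {v | IsEdge P u v ∧ c ⬝ᵥ u < c ⬝ᵥ v}

/-- The slope `ρ^ω(u, v)`. -/
def slopeOf (c ω u v : ι → ℝ) : ℝ :=
  (ω ⬝ᵥ (v - u)) / (c ⬝ᵥ (v - u))

/-- The optimal slope `τ^ω(u)`. For a vertex `u` other than the `c`-maximal one, the set of
improving neighbors is finite and nonempty, so that this supremum is a maximum; the value at the
`c`-maximal vertex (minus infinity by convention) is never used. -/
def optimalSlope (P : Set (ι → ℝ)) (c ω u : ι → ℝ) : ℝ :=
  sSup (slopeOf c ω u '' improvingNeighbors P c u)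

/-- `ω` is a generic weight and `A` is its max-slope arborescence: every vertex `u` with an
improving neighbor has `A u` as its unique improving neighbor of maximal slope, and the vertex
without improving neighbor (the `c`-maximal one) is fixed by `A`. -/
def IsArborescenceOf (P : Set (ι → ℝ)) (c ω : ι → ℝ)
    (A : P.extremePoints ℝ → P.extremePoints ℝ) : Prop :=
  ∀ u : P.extremePoints ℝ,
    ((improvingNeighbors P c u).Nonempty →
      (A u : ι → ℝ) ∈ improvingNeighbors P c u ∧
        ∀ v ∈ improvingNeighbors P c u, v ≠ A u → slopeOf c ω u v < slopeOf c ω u (A u)) ∧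
    (improvingNeighbors P c u = ∅ → A u = u)

/-- The maximal cones of the pivot fan: the closures of the (nonempty) fibers of `ω ↦ A^ω`. -/
def pivotMaximalCones (P : Set (ι → ℝ)) (c : ι → ℝ) : Set (Set (ι → ℝ)) :=
  {C | ∃ A, {ω | IsArborescenceOf P c ω A}.Nonempty ∧ C = closure {ω | IsArborescenceOf P c ω A}}

/-- The pivot fan of `(P, c)`: all the nonempty faces of its maximal cones. -/
def pivotFan (P : Set (ι → ℝ)) (c : ι → ℝ) : Set (Set (ι → ℝ)) :=
  {D | ∃ C ∈ pivotMaximalCones P c, IsExposed ℝ C D ∧ D.Nonempty}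

/-- The normal fan of a polytope `P`: the (outer) normal cones of all the nonempty faces `F`
of `P`, where the normal cone of `F` consists of the directions maximized over `P` on all
of `F`. -/
def normalFan (P : Set (ι → ℝ)) : Set (Set (ι → ℝ)) :=
  {C | ∃ F, IsExposed ℝ P F ∧ F.Nonempty ∧ C = {w | ∀ x ∈ F, ∀ y ∈ P, w ⬝ᵥ y ≤ w ⬝ᵥ x}}

end LinearProgram

/-- `f` is a piecewise linear isomorphism from the fan `𝒞` to the fan `𝒟`: a homeomorphism of the
ambient spaces that is linear on each cone of `𝒞` and maps the cones of `𝒞` onto those of `𝒟`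
(the induced map on cones is injective and preserves inclusions both ways, as `f` is bijective). -/
structure IsPiecewiseLinearFanIso {ι κ : Type} (f : (ι → ℝ) → (κ → ℝ))
    (𝒞 : Set (Set (ι → ℝ))) (𝒟 : Set (Set (κ → ℝ))) : Prop where
  isHomeomorph : IsHomeomorph f
  linear_on : ∀ C ∈ 𝒞, ∃ L : (ι → ℝ) →ₗ[ℝ] (κ → ℝ), Set.EqOn f L C
  image_eq : (fun C => f '' C) '' 𝒞 = 𝒟

/-! ### Slope maps -/

/-- The slope map `θ` of `(P, c)`, where `P` is the polytope with vertices `p 0, …, p m`: the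
`i`-th coordinate of `θ(ω)` is the optimal slope at the `i`-th vertex of `P`, for the vertices sorted
by increasing value of `c`; the last vertex, maximal for `c`, is omitted. -/
def slopeMap {ι : Type} [Fintype ι] {m : ℕ} (p : Fin (m + 1) → ι → ℝ) (c ω : ι → ℝ) : Fin m → ℝ :=
  fun i => optimalSlope (convexHull ℝ (Set.range p)) c ω
    (p (Tuple.sort (fun j => c ⬝ᵥ p j) i.castSucc))

section Product

variable {t : ℕ} {m : Fin t → ℕ}

/-- The component in `ℝ^(m s)` of a vector of `ℝ^(m 1) × ⋯ × ℝ^(m t)`. -/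
def block (x : ((s : Fin t) × Fin (m s)) → ℝ) (s : Fin t) : Fin (m s) → ℝ :=
  fun i => x ⟨s, i⟩

/-- The product of the simplices `Δ s`. -/
def simplexProduct (Δ : (s : Fin t) → Affine.Simplex ℝ (Fin (m s) → ℝ) (m s)) :
    Set (((s : Fin t) × Fin (m s)) → ℝ) :=
  {x | ∀ s, block x s ∈ convexHull ℝ (Set.range (Δ s).points)}

/-- The concatenation of the index sets `[m 1], …, [m t]` (in this order) into `[N]`, where
`N = m 1 + ⋯ + m t`. -/
def concatIndex {N : ℕ} (h : ∑ s, m s = N) : Fin N ≃ (s : Fin t) × Fin (m s) :=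
  (finCongr h.symm).trans finSigmaFinEquiv.symm

/-- The product slope map `Θ`: the concatenation, as a vector of `ℝ^N` with
`N = m 1 + ⋯ + m t`, of the slope vectors `θ_s(ω_s)` of the linear programs `(Δ s, c_s)`. -/
def productSlopeMap {N : ℕ} (h : ∑ s, m s = N)
    (Δ : (s : Fin t) → Affine.Simplex ℝ (Fin (m s) → ℝ) (m s))
    (c ω : ((s : Fin t) × Fin (m s)) → ℝ) : Fin N → ℝ :=
  fun k => slopeMap (Δ (concatIndex h k).1).points (block c (concatIndex h k).1)
    (block ω (concatIndex h k).1) (concatIndex h k).2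

end Product

/-! ### The four polytopes -/

/-- The `n`-permutahedron: the convex hull of all permutations of `(1, …, n)`. -/
def permutahedron (n : ℕ) : Set (Fin n → ℝ) :=
  convexHull ℝ {x | ∃ σ : Equiv.Perm (Fin n), x = fun i => ((σ i : ℕ) : ℝ) + 1}

/-- The `n`-associahedron, as the Minkowski sum of the simplices `conv {-e_j | i ≤ j ≤ k}` over
all `i < k` (the opposite of Loday's associahedron). -/
def associahedron (n : ℕ) : Set (Fin n → ℝ) :=
  ∑ i : Fin n, ∑ k ∈ Finset.Ioi i,
    convexHull ℝ ((fun j : Fin n => -(Pi.single j 1 : Fin n → ℝ)) '' Set.Icc i k)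

/-- The shuffle `P ⋆ Q`: the Minkowski sum of the Cartesian product `P × Q` with all the segments
joining a basis vector of the first factor to a basis vector of the second. -/
def shuffle {m n : ℕ} (P : Set (Fin m → ℝ)) (Q : Set (Fin n → ℝ)) : Set (Fin (m + n) → ℝ) :=
  {x | (fun i => x (Fin.castAdd n i)) ∈ P ∧ (fun j => x (Fin.natAdd m j)) ∈ Q} +
    ∑ i : Fin m, ∑ j : Fin n,
      segment ℝ (Pi.single (Fin.castAdd n i) 1 : Fin (m + n) → ℝ) (Pi.single (Fin.natAdd m j) 1)

/-- The `(m, n)`-constrainahedron: the shuffle of the `m`- and `n`-associahedra. -/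
def constrainahedron (m n : ℕ) : Set (Fin (m + n) → ℝ) :=
  shuffle (associahedron m) (associahedron n)

/-- The `(m, n)`-multiplihedron: the shuffle of the `m`-permutahedron and the
`n`-associahedron. -/
def multiplihedron (m n : ℕ) : Set (Fin (m + n) → ℝ) :=
  shuffle (permutahedron m) (associahedron n)

end

/-! Both fans can be indexed by weights. The normal fan of `Q` consists of the cones `faceCone Q
w₀`, and the pivot fan of the cones `pivotCone P c ω₀`, formed by the weights for which every
optimal neighbor for `ω₀` stays optimal. It is therefore enough that the slope map is a
homeomorphism, linear on each pivot cone, and that ω lies in the cone of ω₀ iff Θ(ω) lies in the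
cone of Θ(ω₀).

For a single simplex, every later vertex is an improving neighbor, so a weight is a list of heights
over the values of `c`, and τ i is the largest slope from point i to a later point. The slope from i
to j is the largest iff τ i ≤ τ k for all k strictly between, and τ j ≤ τ i
(`IsSlopeVector.eq_iff`). Optimal neighbors are thus governed by the positions of the minima of τ
over intervals, which is what the associahedron records (`IsSlopeVector.forall_eq_iff`,
`mem_faceCone_associahedron`). The heights are recovered from τ from the last point backwards, up to
a constant.

In a product, an improving neighbor moves one component only, and its slope depends on that
component only. Hence optimality at a vertex means optimality within one factor, together with
comparisons of slopes between different factors (`mem_pivotCone_product`). The result is the fan of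
`blockFanCone`: interval minima within blocks and all comparisons across blocks. The segments of a
shuffle record these comparisons, and blocks of size one leave nothing else, whence the four
polytopes. -/

noncomputable section

/-! ### Linear functionals as scalar products, faces and normal fans -/

section Faces

variable {ι : Type} [Fintype ι]

theorem exists_dotProduct_eq (l : StrongDual ℝ (ι → ℝ)) : ∃ w : ι → ℝ, ∀ x, l x = w ⬝ᵥ x := by
  classical
  refine ⟨fun i => l (Pi.single i 1), fun x => ?_⟩
  have h := LinearMap.pi_apply_eq_sum_univ (l : (ι → ℝ) →ₗ[ℝ] ℝ) x
  simp only [ContinuousLinearMap.coe_coe] at h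
  rw [h, dotProduct]
  refine Finset.sum_congr rfl fun i _ => ?_
  rw [smul_eq_mul, mul_comm]
  congr 2
  ext j
  simp [Pi.single_apply, eq_comm]

/-- The scalar product with `w`, as a continuous linear functional. -/
def dotFunctional (w : ι → ℝ) : StrongDual ℝ (ι → ℝ) :=
  LinearMap.toContinuousLinearMap
    { toFun := fun x => w ⬝ᵥ x
      map_add' := dotProduct_add w
      map_smul' := fun a x => dotProduct_smul a w x }

@[simp] theorem dotFunctional_apply (w x : ι → ℝ) : dotFunctional w x = w ⬝ᵥ x := rfl

/-- The face of `Q` on which `w` is maximal. -/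
def maxFace (Q : Set (ι → ℝ)) (w : ι → ℝ) : Set (ι → ℝ) :=
  {x ∈ Q | ∀ y ∈ Q, w ⬝ᵥ y ≤ w ⬝ᵥ x}

/-- The cone of the normal fan of `Q` that has `w₀` in its relative interior. -/
def faceCone (Q : Set (ι → ℝ)) (w₀ : ι → ℝ) : Set (ι → ℝ) :=
  {w | maxFace Q w₀ ⊆ maxFace Q w}

/-- Every linear functional attains its maximum on `Q`. -/
def HasMaxFaces (Q : Set (ι → ℝ)) : Prop := ∀ w, (maxFace Q w).Nonempty

theorem isExposed_maxFace (Q : Set (ι → ℝ)) (w : ι → ℝ) : IsExposed ℝ Q (maxFace Q w) :=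
  fun _ => ⟨dotFunctional w, rfl⟩

theorem IsExposed.exists_eq_maxFace {Q F : Set (ι → ℝ)} (h : IsExposed ℝ Q F)
    (hF : F.Nonempty) : ∃ w, F = maxFace Q w := by
  obtain ⟨l, hl⟩ := h hF
  obtain ⟨w, hw⟩ := exists_dotProduct_eq l
  exact ⟨w, by simp only [hl, hw, maxFace]⟩

/-- A normal cone depends only on its face, and every nonempty exposed face is cut out by some
weight; conversely `hQ` makes the face of every weight nonempty. -/
theorem normalFan_eq_range {Q : Set (ι → ℝ)} (hQ : HasMaxFaces Q) :
    normalFan Q = Set.range (faceCone Q) := by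
  have key : ∀ w₀, {w | ∀ x ∈ maxFace Q w₀, ∀ y ∈ Q, w ⬝ᵥ y ≤ w ⬝ᵥ x} = faceCone Q w₀ :=
    fun w₀ => Set.ext fun w => ⟨fun h x hx => ⟨hx.1, h x hx⟩, fun h x hx => (h hx).2⟩
  ext C
  constructor
  · rintro ⟨F, hF, hne, rfl⟩
    obtain ⟨w₀, rfl⟩ := hF.exists_eq_maxFace hne
    exact ⟨w₀, (key w₀).symm⟩
  · rintro ⟨w₀, rfl⟩
    exact ⟨maxFace Q w₀, isExposed_maxFace Q w₀, hQ w₀, (key w₀).symm⟩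

theorem add_mem_maxFace {Q R : Set (ι → ℝ)} {w x y : ι → ℝ} (hx : x ∈ maxFace Q w)
    (hy : y ∈ maxFace R w) : x + y ∈ maxFace (Q + R) w := by
  refine ⟨Set.add_mem_add hx.1 hy.1, ?_⟩
  rintro _ ⟨a, ha, b, hb, rfl⟩
  simp only [dotProduct_add]
  exact add_le_add (hx.2 a ha) (hy.2 b hb)

theorem mem_maxFace_of_add_mem {Q R : Set (ι → ℝ)} {w x y : ι → ℝ} (hx : x ∈ Q)
    (hy : y ∈ R) (h : x + y ∈ maxFace (Q + R) w) : x ∈ maxFace Q w ∧ y ∈ maxFace R w := by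
  refine ⟨⟨hx, fun a ha => ?_⟩, ⟨hy, fun b hb => ?_⟩⟩
  · have := h.2 _ (Set.add_mem_add ha hy)
    simp only [dotProduct_add] at this
    linarith
  · have := h.2 _ (Set.add_mem_add hx hb)
    simp only [dotProduct_add] at this
    linarith

theorem HasMaxFaces.add {Q R : Set (ι → ℝ)} (hQ : HasMaxFaces Q) (hR : HasMaxFaces R) :
    HasMaxFaces (Q + R) := fun w =>
  let ⟨_, hx⟩ := hQ w
  let ⟨_, hy⟩ := hR w
  ⟨_, add_mem_maxFace hx hy⟩

/-- A sum of two points is maximal iff both summands are, so the normal fan of a Minkowski sum is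
the common refinement of the normal fans. -/
theorem faceCone_add {Q R : Set (ι → ℝ)} (hQ : HasMaxFaces Q) (hR : HasMaxFaces R)
    (w₀ : ι → ℝ) : faceCone (Q + R) w₀ = faceCone Q w₀ ∩ faceCone R w₀ := by
  ext w
  constructor
  · intro h
    refine ⟨fun x hx => ?_, fun y hy => ?_⟩
    · obtain ⟨y, hy⟩ := hR w₀
      exact (mem_maxFace_of_add_mem hx.1 hy.1 (h (add_mem_maxFace hx hy))).1
    · obtain ⟨x, hx⟩ := hQ w₀
      exact (mem_maxFace_of_add_mem hx.1 hy.1 (h (add_mem_maxFace hx hy))).2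
  · rintro ⟨h₁, h₂⟩ z hz
    obtain ⟨x, hx, y, hy, rfl⟩ := hz.1
    obtain ⟨hx', hy'⟩ := mem_maxFace_of_add_mem hx hy hz
    exact add_mem_maxFace (h₁ hx') (h₂ hy')

theorem hasMaxFaces_zero : HasMaxFaces (0 : Set (ι → ℝ)) := fun w =>
  ⟨0, Set.zero_mem_zero, by simp⟩

theorem faceCone_zero (w₀ : ι → ℝ) : faceCone (0 : Set (ι → ℝ)) w₀ = Set.univ := by
  refine Set.eq_univ_of_forall fun w x hx => ⟨hx.1, ?_⟩
  have hx0 : x = 0 := hx.1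
  rintro y rfl
  rw [hx0]

theorem HasMaxFaces.sum {κ : Type*} {s : Finset κ} {Q : κ → Set (ι → ℝ)}
    (hQ : ∀ i ∈ s, HasMaxFaces (Q i)) : HasMaxFaces (∑ i ∈ s, Q i) :=
  Finset.sum_induction Q HasMaxFaces (fun _ _ => HasMaxFaces.add) hasMaxFaces_zero hQ

theorem mem_faceCone_sum {κ : Type*} {s : Finset κ} {Q : κ → Set (ι → ℝ)}
    (hQ : ∀ i ∈ s, HasMaxFaces (Q i)) {w₀ w : ι → ℝ} :
    w ∈ faceCone (∑ i ∈ s, Q i) w₀ ↔ ∀ i ∈ s, w ∈ faceCone (Q i) w₀ := by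
  classical
  induction s using Finset.induction_on with
  | empty => simp [faceCone_zero]
  | insert a s ha ih =>
    have hs : ∀ i ∈ s, HasMaxFaces (Q i) := fun i hi => hQ i (Finset.mem_insert_of_mem hi)
    rw [Finset.sum_insert ha, faceCone_add (hQ a (Finset.mem_insert_self a s)) (.sum hs),
      Set.mem_inter_iff, ih hs, Finset.forall_mem_insert]

theorem hasMaxFaces_convexHull {S : Set (ι → ℝ)} (hS : S.Finite) (hne : S.Nonempty) :
    HasMaxFaces (convexHull ℝ S) := fun w => by
  obtain ⟨x, hx, hmax⟩ := (hS.isCompact_convexHull (𝕜 := ℝ)).exists_isMaxOn hne.convexHull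
    (dotFunctional w).continuous.continuousOn
  exact ⟨x, hx, hmax⟩

theorem dotProduct_le_of_mem_convexHull {S : Set (ι → ℝ)} {w : ι → ℝ} {a : ℝ}
    (h : ∀ y ∈ S, w ⬝ᵥ y ≤ a) {x : ι → ℝ} (hx : x ∈ convexHull ℝ S) : w ⬝ᵥ x ≤ a :=
  convexHull_min (t := {y | dotFunctional w y ≤ a}) h
    (convex_halfSpace_le (dotFunctional w).isLinear a) hx

/-- In a convex combination reaching the maximum, each point with nonzero coefficient must reach it.
-/
theorem maxFace_convexHull (S : Set (ι → ℝ)) (w : ι → ℝ) :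
    maxFace (convexHull ℝ S) w = convexHull ℝ (maxFace S w) := by
  apply subset_antisymm
  · intro x hx
    obtain ⟨κ, _, a, z, ha, hsum, hz, hxz⟩ := mem_convexHull_iff_exists_fintype.1 hx.1
    have hz' : ∀ i, z i ∈ convexHull ℝ S := fun i => subset_convexHull ℝ S (hz i)
    have hdot : w ⬝ᵥ x = ∑ i, a i * (w ⬝ᵥ z i) := by
      rw [← hxz, dotProduct_sum]
      simp
    have hmax : ∀ i, a i ≠ 0 → z i ∈ maxFace S w := by
      intro i hi
      refine ⟨hz i, fun y hy => ?_⟩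
      by_contra! hlt
      have hlt' : w ⬝ᵥ z i < w ⬝ᵥ x := hlt.trans_le (hx.2 y (subset_convexHull ℝ S hy))
      have : ∑ j, a j * (w ⬝ᵥ z j) < ∑ j, a j * (w ⬝ᵥ x) := by
        refine Finset.sum_lt_sum (fun j _ => mul_le_mul_of_nonneg_left (hx.2 _ (hz' j)) (ha j))
          ⟨i, Finset.mem_univ i, ?_⟩
        exact mul_lt_mul_of_pos_left hlt' ((ha i).lt_of_ne' hi)
      rw [← hdot, ← Finset.sum_mul, hsum, one_mul] at this
      exact this.false
    classical
    rw [← hxz, ← Finset.sum_filter_of_ne (p := fun i => a i ≠ 0)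
      fun i _ hi h0 => hi (by rw [h0, zero_smul])]
    refine (convex_convexHull ℝ _).sum_mem (fun i _ => ha i) ?_ fun i hi =>
      subset_convexHull ℝ _ (hmax i (Finset.mem_filter.1 hi).2)
    rw [Finset.sum_filter_of_ne fun i _ hi => hi, hsum]
  · exact convexHull_min (fun x hx => ⟨subset_convexHull ℝ S hx.1, fun y hy =>
      dotProduct_le_of_mem_convexHull hx.2 hy⟩)
      ((isExposed_maxFace _ w).convex (convex_convexHull ℝ S))

theorem mem_faceCone_convexHull {S : Set (ι → ℝ)} {w₀ w : ι → ℝ} :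
    w ∈ faceCone (convexHull ℝ S) w₀ ↔ maxFace S w₀ ⊆ maxFace S w := by
  rw [faceCone, Set.mem_ofPred_eq, maxFace_convexHull]
  constructor
  · intro h x hx
    exact ⟨hx.1, fun y hy => (h (subset_convexHull ℝ _ hx)).2 y (subset_convexHull ℝ S hy)⟩
  · intro h
    rw [maxFace_convexHull]
    exact convexHull_mono h

theorem mem_faceCone_convexHull_image {κ : Type*} {J : Set κ} {p : κ → ι → ℝ} {w₀ w : ι → ℝ} :
    w ∈ faceCone (convexHull ℝ (p '' J)) w₀ ↔
      ∀ j ∈ J, (∀ k ∈ J, w₀ ⬝ᵥ p k ≤ w₀ ⬝ᵥ p j) → ∀ k ∈ J, w ⬝ᵥ p k ≤ w ⬝ᵥ p j := by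
  rw [mem_faceCone_convexHull]
  constructor
  · intro h j hj hmax k hk
    exact (h ⟨Set.mem_image_of_mem p hj, by rintro _ ⟨k, hk, rfl⟩; exact hmax k hk⟩).2 _
      (Set.mem_image_of_mem p hk)
  · rintro h _ ⟨⟨j, hj, rfl⟩, hmax⟩
    refine ⟨Set.mem_image_of_mem p hj, ?_⟩
    rintro _ ⟨k, hk, rfl⟩
    exact h j hj (fun k hk => hmax _ (Set.mem_image_of_mem p hk)) k hk

theorem hasMaxFaces_segment (u v : ι → ℝ) : HasMaxFaces (segment ℝ u v) := by
  rw [← convexHull_pair]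
  exact hasMaxFaces_convexHull (Set.toFinite _) (Set.insert_nonempty u {v})

theorem mem_faceCone_segment {u v w₀ w : ι → ℝ} :
    w ∈ faceCone (segment ℝ u v) w₀ ↔ (w₀ ⬝ᵥ v ≤ w₀ ⬝ᵥ u → w ⬝ᵥ v ≤ w ⬝ᵥ u) ∧
      (w₀ ⬝ᵥ u ≤ w₀ ⬝ᵥ v → w ⬝ᵥ u ≤ w ⬝ᵥ v) := by
  have := mem_faceCone_convexHull_image (J := {u, v}) (p := id) (w₀ := w₀) (w := w)
  rw [Set.image_id, convexHull_pair] at this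
  simp [this]

end Faces

/-! ### The normal fans of the four polytopes -/

/-- `w b` is minimal among the values of `w` between `a` and `b`. -/
def IsMinBetween {n : ℕ} (w : Fin n → ℝ) (a b : Fin n) : Prop :=
  ∀ k ∈ Set.uIcc a b, w b ≤ w k

section Polytopes

theorem hasMaxFaces_associahedron (n : ℕ) : HasMaxFaces (associahedron n) := by
  refine HasMaxFaces.sum fun i _ => HasMaxFaces.sum fun k hk => hasMaxFaces_convexHull
    (Set.toFinite _) (Set.Nonempty.image _ ⟨i, le_rfl, (Finset.mem_Ioi.1 hk).le⟩)

/-- The signs of the vertices `-e_j` turn maxima into minima, so each summand records where the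
minimum over its interval is attained. -/
theorem mem_faceCone_associahedron {n : ℕ} {w₀ w : Fin n → ℝ} :
    w ∈ faceCone (associahedron n) w₀ ↔ ∀ a b, IsMinBetween w₀ a b → w b ≤ w a := by
  have hne : ∀ i : Fin n, ∀ k ∈ Finset.Ioi i, HasMaxFaces
      (convexHull ℝ ((fun j : Fin n => -(Pi.single j 1 : Fin n → ℝ)) '' Set.Icc i k)) :=
    fun i k hk => hasMaxFaces_convexHull
      (Set.toFinite _) (Set.Nonempty.image _ ⟨i, le_rfl, (Finset.mem_Ioi.1 hk).le⟩)
  rw [associahedron, mem_faceCone_sum fun i _ => HasMaxFaces.sum (hne i)]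
  simp only [Finset.mem_univ, true_implies]
  have : ∀ i, (w ∈ faceCone (∑ k ∈ Finset.Ioi i, convexHull ℝ
      ((fun j : Fin n => -(Pi.single j 1 : Fin n → ℝ)) '' Set.Icc i k)) w₀) ↔
      ∀ k, i < k → ∀ j ∈ Set.Icc i k, (∀ l ∈ Set.Icc i k, w₀ j ≤ w₀ l) →
        ∀ l ∈ Set.Icc i k, w j ≤ w l := by
    intro i
    rw [mem_faceCone_sum (hne i)]
    simp only [Finset.mem_Ioi, mem_faceCone_convexHull_image, dotProduct_neg,
      dotProduct_single_one, neg_le_neg_iff]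
  simp only [this]
  constructor
  · intro h a b hab
    rcases lt_trichotomy a b with hlt | rfl | hlt
    · refine h a b hlt b ⟨hlt.le, le_rfl⟩ (fun l hl => hab l ?_) a ⟨le_rfl, hlt.le⟩
      rwa [Set.uIcc_of_le hlt.le]
    · exact le_rfl
    · refine h b a hlt b ⟨le_rfl, hlt.le⟩ (fun l hl => hab l ?_) a ⟨hlt.le, le_rfl⟩
      rwa [Set.uIcc_of_ge hlt.le]
  -- A minimum over `[i, k]` attained at `j` is also one over the smaller interval between `l` and
  -- `j`.
  · intro h i k _ j hj hmin l hl
    exact h l j fun x hx => hmin x (Set.uIcc_subset_Icc hl hj hx)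

/-! ### Normal cones of the permutahedron. -/

theorem dotProduct_perm_swap {n : ℕ} (w : Fin n → ℝ) (σ : Equiv.Perm (Fin n)) {a b : Fin n}
    (hab : a ≠ b) :
    (w ⬝ᵥ fun i => ((σ (Equiv.swap a b i) : ℕ) : ℝ) + 1) -
        w ⬝ᵥ (fun i => ((σ i : ℕ) : ℝ) + 1) =
      (w a - w b) * (((σ b : ℕ) : ℝ) - (σ a : ℕ)) := by
  rw [← dotProduct_sub, dotProduct, ← Finset.sum_subset (Finset.subset_univ {a, b}),
    Finset.sum_pair hab]
  · simp only [Pi.sub_apply, Equiv.swap_apply_left, Equiv.swap_apply_right]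
    ring
  · intro i _ hi
    simp only [Finset.mem_insert, Finset.mem_singleton, not_or] at hi
    simp [Equiv.swap_apply_of_ne_of_ne hi.1 hi.2]

/-- The vertices of the permutahedron that are maximal for `w`. -/
theorem isMax_perm_iff {n : ℕ} {w : Fin n → ℝ} {σ : Equiv.Perm (Fin n)} :
    (∀ π : Equiv.Perm (Fin n), (w ⬝ᵥ fun i => ((π i : ℕ) : ℝ) + 1) ≤
      w ⬝ᵥ fun i => ((σ i : ℕ) : ℝ) + 1) ↔ ∀ a b, σ b < σ a → w b ≤ w a := by
  constructor
  · intro h a b hab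
    have hne : a ≠ b := by rintro rfl; exact hab.false
    have h1 := dotProduct_perm_swap w σ hne
    have h2 := h ((Equiv.swap a b).trans σ)
    simp only [Equiv.trans_apply] at h2
    have h3 : ((σ b : ℕ) : ℝ) < (σ a : ℕ) := by exact_mod_cast hab
    by_contra! hlt
    nlinarith [mul_pos (sub_pos.2 hlt) (sub_pos.2 h3)]
  · intro h π
    have hmono : Monovary w (fun i => ((σ i : ℕ) : ℝ) + 1) := by
      intro a b hab
      refine h b a ?_
      simp only [add_lt_add_iff_right, Nat.cast_lt] at hab
      exact hab
    -- Rearrangement inequality: permuting the values of `σ` by `σ⁻¹ ∘ π` gives those of `π`.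
    have := hmono.sum_mul_comp_perm_le_sum_mul (σ := π.trans σ.symm)
    simpa [dotProduct] using this

theorem setOf_perm_eq_image (n : ℕ) :
    {x : Fin n → ℝ | ∃ σ : Equiv.Perm (Fin n), x = fun i => ((σ i : ℕ) : ℝ) + 1} =
      (fun (σ : Equiv.Perm (Fin n)) i => ((σ i : ℕ) : ℝ) + 1) '' Set.univ := by
  ext x
  simp [eq_comm]

theorem hasMaxFaces_permutahedron (n : ℕ) : HasMaxFaces (permutahedron n) := by
  rw [permutahedron, setOf_perm_eq_image]
  exact hasMaxFaces_convexHull (Set.toFinite _) (Set.univ_nonempty.image _)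

/-- A permutation that sorts `w`, ties at `a` being broken in favour of `a`. -/
theorem exists_perm_sort {n : ℕ} (w : Fin n → ℝ) (a : Fin n) :
    ∃ σ : Equiv.Perm (Fin n), (∀ i j, σ j < σ i → w j ≤ w i) ∧
      ∀ b ≠ a, w b ≤ w a → σ b < σ a := by
  -- The second component places `a` after all the indices tied with it.
  let f : Fin n → ℝ ×ₗ ℕ := fun i => toLex (w i, if i = a then 1 else 0)
  have hmono := Tuple.monotone_sort f
  have key : ∀ i j, (Tuple.sort f).symm j < (Tuple.sort f).symm i → f j ≤ f i := by
    intro i j hij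
    simpa using hmono hij.le
  refine ⟨(Tuple.sort f).symm, fun i j hij => ?_, fun b hb hba => ?_⟩
  · have := key i j hij
    simp only [f, Prod.Lex.toLex_le_toLex] at this
    rcases this with h | h
    exacts [h.le, h.1.le]
  · have hlt : f b < f a := by
      simp only [f, Prod.Lex.toLex_lt_toLex, if_neg hb]
      rcases hba.lt_or_eq with h | h
      · exact Or.inl h
      · exact Or.inr ⟨h, by simp⟩
    by_contra! hle
    rcases hle.lt_or_eq with h | h
    · exact (key b a h).not_gt hlt
    · exact hb ((Tuple.sort f).symm.injective h).symm

/-- Each weak inequality `w₀ b ≤ w₀ a` with `b ≠ a` is witnessed by a `w₀`-maximal permutation that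
puts `b` below `a`; ties are witnessed in both directions. -/
theorem mem_faceCone_permutahedron {n : ℕ} {w₀ w : Fin n → ℝ} :
    w ∈ faceCone (permutahedron n) w₀ ↔ ∀ a b, w₀ b ≤ w₀ a → w b ≤ w a := by
  rw [permutahedron, setOf_perm_eq_image, mem_faceCone_convexHull_image]
  simp only [Set.mem_univ, true_implies, isMax_perm_iff]
  constructor
  · intro h a b hab
    rcases eq_or_ne b a with rfl | hne
    · exact le_rfl
    · obtain ⟨σ, hσ, hlt⟩ := exists_perm_sort w₀ a
      exact h σ hσ a b (hlt b hne hab)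
  · intro h σ hσ a b hab
    exact h a b (hσ a b hab)

/-! ### Normal cones of Cartesian products and shuffles. -/

section Shuffle

variable {m n : ℕ}

theorem dotProduct_add_append (w x : Fin (m + n) → ℝ) :
    w ⬝ᵥ x = (fun i => w (Fin.castAdd n i)) ⬝ᵥ (fun i => x (Fin.castAdd n i)) +
      (fun j => w (Fin.natAdd m j)) ⬝ᵥ (fun j => x (Fin.natAdd m j)) :=
  Fin.sum_univ_add _

theorem mem_maxFace_prod {P : Set (Fin m → ℝ)} {Q : Set (Fin n → ℝ)} {w x : Fin (m + n) → ℝ} :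
    x ∈ maxFace {x : Fin (m + n) → ℝ | (fun i => x (Fin.castAdd n i)) ∈ P ∧
        (fun j => x (Fin.natAdd m j)) ∈ Q} w ↔
      (fun i => x (Fin.castAdd n i)) ∈ maxFace P (fun i => w (Fin.castAdd n i)) ∧
        (fun j => x (Fin.natAdd m j)) ∈ maxFace Q (fun j => w (Fin.natAdd m j)) := by
  constructor
  · rintro ⟨⟨h₁, h₂⟩, hmax⟩
    refine ⟨⟨h₁, fun y hy => ?_⟩, ⟨h₂, fun y hy => ?_⟩⟩
    · have := hmax (Fin.append y fun j => x (Fin.natAdd m j)) (by simpa using ⟨hy, h₂⟩)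
      rw [dotProduct_add_append, dotProduct_add_append w x] at this
      simpa using this
    · have := hmax (Fin.append (fun i => x (Fin.castAdd n i)) y) (by simpa using ⟨h₁, hy⟩)
      rw [dotProduct_add_append, dotProduct_add_append w x] at this
      simpa using this
  · rintro ⟨h₁, h₂⟩
    refine ⟨⟨h₁.1, h₂.1⟩, fun y hy => ?_⟩
    rw [dotProduct_add_append, dotProduct_add_append w x]
    exact add_le_add (h₁.2 _ hy.1) (h₂.2 _ hy.2)

theorem append_mem_maxFace_prod {P : Set (Fin m → ℝ)} {Q : Set (Fin n → ℝ)}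
    {w : Fin (m + n) → ℝ} {x : Fin m → ℝ} {y : Fin n → ℝ}
    (hx : x ∈ maxFace P fun i => w (Fin.castAdd n i))
    (hy : y ∈ maxFace Q fun j => w (Fin.natAdd m j)) :
    Fin.append x y ∈ maxFace {x : Fin (m + n) → ℝ | (fun i => x (Fin.castAdd n i)) ∈ P ∧
        (fun j => x (Fin.natAdd m j)) ∈ Q} w :=
  mem_maxFace_prod.2 (by simpa using ⟨hx, hy⟩)

theorem hasMaxFaces_prod {P : Set (Fin m → ℝ)} {Q : Set (Fin n → ℝ)} (hP : HasMaxFaces P)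
    (hQ : HasMaxFaces Q) : HasMaxFaces {x : Fin (m + n) → ℝ |
      (fun i => x (Fin.castAdd n i)) ∈ P ∧ (fun j => x (Fin.natAdd m j)) ∈ Q} := fun w => by
  obtain ⟨x, hx⟩ := hP fun i => w (Fin.castAdd n i)
  obtain ⟨y, hy⟩ := hQ fun j => w (Fin.natAdd m j)
  exact ⟨Fin.append x y, append_mem_maxFace_prod hx hy⟩

theorem mem_faceCone_prod {P : Set (Fin m → ℝ)} {Q : Set (Fin n → ℝ)} (hP : HasMaxFaces P)
    (hQ : HasMaxFaces Q) {w₀ w : Fin (m + n) → ℝ} :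
    w ∈ faceCone {x : Fin (m + n) → ℝ | (fun i => x (Fin.castAdd n i)) ∈ P ∧
        (fun j => x (Fin.natAdd m j)) ∈ Q} w₀ ↔
      (fun i => w (Fin.castAdd n i)) ∈ faceCone P (fun i => w₀ (Fin.castAdd n i)) ∧
        (fun j => w (Fin.natAdd m j)) ∈ faceCone Q (fun j => w₀ (Fin.natAdd m j)) := by
  constructor
  · intro h
    refine ⟨fun x hx => ?_, fun y hy => ?_⟩
    · obtain ⟨y, hy⟩ := hQ fun j => w₀ (Fin.natAdd m j)
      have := (mem_maxFace_prod.1 (h (append_mem_maxFace_prod hx hy))).1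
      simpa using this
    · obtain ⟨x, hx⟩ := hP fun i => w₀ (Fin.castAdd n i)
      have := (mem_maxFace_prod.1 (h (append_mem_maxFace_prod hx hy))).2
      simpa using this
  · rintro ⟨h₁, h₂⟩ x hx
    obtain ⟨hx₁, hx₂⟩ := mem_maxFace_prod.1 hx
    exact mem_maxFace_prod.2 ⟨h₁ hx₁, h₂ hx₂⟩

theorem hasMaxFaces_shuffle {P : Set (Fin m → ℝ)} {Q : Set (Fin n → ℝ)} (hP : HasMaxFaces P)
    (hQ : HasMaxFaces Q) : HasMaxFaces (shuffle P Q) :=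
  (hasMaxFaces_prod hP hQ).add (HasMaxFaces.sum fun _ _ => HasMaxFaces.sum fun _ _ =>
    hasMaxFaces_segment _ _)

/-- The normal cone of a product is the product of the normal cones; each added segment contributes
the comparison of one coordinate of each factor. -/
theorem mem_faceCone_shuffle {P : Set (Fin m → ℝ)} {Q : Set (Fin n → ℝ)} (hP : HasMaxFaces P)
    (hQ : HasMaxFaces Q) {w₀ w : Fin (m + n) → ℝ} :
    w ∈ faceCone (shuffle P Q) w₀ ↔
      ((fun i => w (Fin.castAdd n i)) ∈ faceCone P (fun i => w₀ (Fin.castAdd n i)) ∧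
        (fun j => w (Fin.natAdd m j)) ∈ faceCone Q (fun j => w₀ (Fin.natAdd m j))) ∧
      ∀ i j, (w₀ (Fin.natAdd m j) ≤ w₀ (Fin.castAdd n i) →
          w (Fin.natAdd m j) ≤ w (Fin.castAdd n i)) ∧
        (w₀ (Fin.castAdd n i) ≤ w₀ (Fin.natAdd m j) →
          w (Fin.castAdd n i) ≤ w (Fin.natAdd m j)) := by
  rw [shuffle, faceCone_add (hasMaxFaces_prod hP hQ) (HasMaxFaces.sum fun _ _ =>
    HasMaxFaces.sum fun _ _ => hasMaxFaces_segment _ _), Set.mem_inter_iff,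
    mem_faceCone_prod hP hQ, mem_faceCone_sum fun _ _ => HasMaxFaces.sum fun _ _ =>
    hasMaxFaces_segment _ _]
  simp only [Finset.mem_univ, true_implies, dotProduct_single_one,
    mem_faceCone_sum fun _ _ => hasMaxFaces_segment _ _, mem_faceCone_segment]

end Shuffle

end Polytopes

/-! ### Slopes of a sequence of points in the plane -/

section Slopes

variable {m : ℕ}

/-- `τ i` is the maximal slope from the `i`-th point `(x i, y i)` to a later one. -/
def IsSlopeVector (x y : Fin (m + 1) → ℝ) (τ : Fin m → ℝ) : Prop :=
  ∀ i : Fin m, IsGreatest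
    ((fun j => (y j - y i.castSucc) / (x j - x i.castSucc)) '' Set.Ioi i.castSucc) (τ i)

variable {x y y₀ : Fin (m + 1) → ℝ} {τ τ₀ : Fin m → ℝ}

theorem IsSlopeVector.exists_eq (h : IsSlopeVector x y τ) (hx : StrictMono x) (i : Fin m) :
    ∃ j, i.castSucc < j ∧ y j - y i.castSucc = τ i * (x j - x i.castSucc) := by
  obtain ⟨j, hj, hji⟩ := (h i).1
  refine ⟨j, hj, ?_⟩
  have : 0 < x j - x i.castSucc := sub_pos.2 (hx hj)
  rw [← hji, div_mul_cancel₀ _ this.ne']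

theorem IsSlopeVector.le (h : IsSlopeVector x y τ) (hx : StrictMono x) (i : Fin m)
    {j : Fin (m + 1)} (hj : i.castSucc < j) :
    y j - y i.castSucc ≤ τ i * (x j - x i.castSucc) := by
  have : 0 < x j - x i.castSucc := sub_pos.2 (hx hj)
  exact (div_le_iff₀ this).1 ((h i).2 ⟨j, hj, rfl⟩)

theorem isSlopeVector_iff (hx : StrictMono x) : IsSlopeVector x y τ ↔ ∀ i : Fin m,
    (∃ j, i.castSucc < j ∧ y j - y i.castSucc = τ i * (x j - x i.castSucc)) ∧
      ∀ j, i.castSucc < j → y j - y i.castSucc ≤ τ i * (x j - x i.castSucc) := by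
  refine ⟨fun h i => ⟨h.exists_eq hx i, fun j hj => h.le hx i hj⟩, fun h i => ⟨?_, ?_⟩⟩
  · obtain ⟨j, hj, hji⟩ := (h i).1
    refine ⟨j, hj, ?_⟩
    have : 0 < x j - x i.castSucc := sub_pos.2 (hx hj)
    simp only [hji]
    rw [mul_div_cancel_right₀ _ this.ne']
  · rintro _ ⟨j, hj, rfl⟩
    have : 0 < x j - x i.castSucc := sub_pos.2 (hx hj)
    exact (div_le_iff₀ this).2 ((h i).2 j hj)

/-- The slope from `i` to `j` is the maximal one iff no point strictly between has smaller
maximal slope, and the maximal slope at `j` is not larger. -/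
theorem IsSlopeVector.eq_iff (h : IsSlopeVector x y τ) (hx : StrictMono x) (i : Fin m)
    {j : Fin (m + 1)} (hj : i.castSucc < j) :
    y j - y i.castSucc = τ i * (x j - x i.castSucc) ↔
      (∀ k, i < k → k.castSucc < j → τ i ≤ τ k) ∧
        ∀ k : Fin m, k.castSucc = j → τ k ≤ τ i := by
  constructor
  · intro heq
    refine ⟨fun k hik hkj => ?_, ?_⟩
    · have h1 := h.le hx i (Fin.castSucc_lt_castSucc_iff.2 hik)
      have h2 := h.le hx k hkj
      have h3 : 0 < x j - x k.castSucc := sub_pos.2 (hx hkj)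
      by_contra! hlt
      nlinarith [mul_pos (sub_pos.2 hlt) h3]
    · rintro k rfl
      obtain ⟨l, hl, hlk⟩ := h.exists_eq hx k
      have h1 := h.le hx i (hj.trans hl)
      have h3 : 0 < x l - x k.castSucc := sub_pos.2 (hx hl)
      by_contra! hlt
      nlinarith [mul_pos (sub_pos.2 hlt) h3]
  · rintro ⟨h1, h2⟩
    by_contra hne
    have hlt := (h.le hx i hj).lt_of_ne hne
    -- the last point before `j` on the line of slope `τ i` through the `i`-th point
    obtain ⟨l, ⟨hil, hlj, hl⟩, hmax⟩ := Set.Finite.exists_maximal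
      (s := {l : Fin m | i ≤ l ∧ l.castSucc < j ∧
        y l.castSucc - y i.castSucc = τ i * (x l.castSucc - x i.castSucc)})
      (Set.toFinite _) ⟨i, le_rfl, hj, by simp⟩
    have hτ : τ i ≤ τ l := by
      rcases hil.lt_or_eq with h' | rfl
      exacts [h1 l h' hlj, le_rfl]
    obtain ⟨k, hk, hkl⟩ := h.exists_eq hx l
    have hkx : 0 < x k - x l.castSucc := sub_pos.2 (hx hk)
    have hik : i.castSucc < k := (Fin.castSucc_le_castSucc_iff.2 hil).trans_lt hk
    have hki := h.le hx i hik
    -- As `τ l ≥ τ i`, the point `k` is not below the line of slope `τ i` through `i`, and by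
    -- maximality of `τ i` it is not above.
    have hk_eq : y k - y i.castSucc = τ i * (x k - x i.castSucc) := by
      nlinarith [mul_nonneg (sub_nonneg.2 hτ) hkx.le]
    rcases lt_trichotomy k j with hkj | rfl | hkj
    · obtain ⟨k', rfl⟩ := Fin.exists_castSucc_eq.2 (Fin.ne_last_of_lt hkj)
      have hlk := Fin.castSucc_lt_castSucc_iff.1 hk
      exact (hmax ⟨hil.trans hlk.le, hkj, hk_eq⟩ hlk.le).not_gt hlk
    · exact hne hk_eq
    -- Here `j` is strictly below the line and the later point `k` is on it, so the slope from `j`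
    -- to `k` exceeds `τ i`, against `τ j ≤ τ i`.
    · obtain ⟨j', rfl⟩ := Fin.exists_castSucc_eq.2 (Fin.ne_last_of_lt hkj)
      have h3 := h.le hx j' hkj
      have h4 := h2 j' rfl
      have h5 : 0 < x k - x j'.castSucc := sub_pos.2 (hx hkj)
      nlinarith [mul_nonneg (sub_nonneg.2 h4) h5.le]

theorem isMinBetween_of_lt {a b : Fin m} (hab : a < b)
    (h : ∀ k, a ≤ k → k ≤ b → τ b ≤ τ k) : IsMinBetween τ a b := fun k hk => by
  rw [Set.uIcc_of_le hab.le] at hk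
  exact h k hk.1 hk.2

theorem isMinBetween_of_gt {a b : Fin m} (hab : b < a)
    (h : ∀ k, b ≤ k → k ≤ a → τ b ≤ τ k) : IsMinBetween τ a b := fun k hk => by
  rw [Set.uIcc_of_ge hab.le] at hk
  exact h k hk.1 hk.2

/-- Both cases exhibit an optimal slope of the first weight and read the inequality off its
optimality for the second. If `a < b`, the first `j > a` with `τ₀ j ≤ τ₀ a` is an optimal target of
`a`, so `τ j ≤ τ a`; iterating from `j` leads to `b`. If `b < a`, the first point after `a` whose
slope is at most `τ₀ b` is an optimal target of `b`, and `a` lies strictly before it. -/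
theorem IsSlopeVector.isMinBetween_of_eq (h₀ : IsSlopeVector x y₀ τ₀) (h : IsSlopeVector x y τ)
    (hx : StrictMono x) (hτ : ∀ (i : Fin m) (j : Fin (m + 1)), i.castSucc < j →
      y₀ j - y₀ i.castSucc = τ₀ i * (x j - x i.castSucc) →
      y j - y i.castSucc = τ i * (x j - x i.castSucc)) {a b : Fin m}
    (hab : IsMinBetween τ₀ a b) : τ b ≤ τ a := by
  rcases lt_trichotomy a b with hlt | rfl | hlt
  · induction a using WellFoundedGT.induction with
    | _ a ih =>
      rw [IsMinBetween, Set.uIcc_of_le hlt.le] at hab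
      obtain ⟨j, ⟨haj, hja⟩, hmin⟩ := Set.Finite.exists_minimal
        (s := {k : Fin m | a < k ∧ τ₀ k ≤ τ₀ a}) (Set.toFinite _)
        ⟨b, hlt, hab a ⟨le_rfl, hlt.le⟩⟩
      have hlt' : ∀ k, a < k → k < j → τ₀ a ≤ τ₀ k := fun k hak hkj => by
        by_contra! h'
        exact (hmin ⟨hak, h'.le⟩ hkj.le).not_gt hkj
      have hjb : j ≤ b := by
        by_contra! h'
        exact (hmin ⟨hlt, hab a ⟨le_rfl, hlt.le⟩⟩ h'.le).not_gt h'
      have haj' := Fin.castSucc_lt_castSucc_iff.2 haj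
      have heq := hτ a j.castSucc haj' ((h₀.eq_iff hx a haj').2
        ⟨fun k hak hkj => hlt' k hak (Fin.castSucc_lt_castSucc_iff.1 hkj), fun k hk => by
          rwa [Fin.castSucc_injective m hk]⟩)
      have h1 := ((h.eq_iff hx a haj').1 heq).2 j rfl
      rcases hjb.lt_or_eq with hjb | rfl
      · refine (ih j haj (fun k hk => ?_) hjb).trans h1
        rw [Set.uIcc_of_le hjb.le] at hk
        exact hab k ⟨haj.le.trans hk.1, hk.2⟩
      · exact h1
  · exact le_rfl
  · rw [IsMinBetween, Set.uIcc_of_ge hlt.le] at hab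
    obtain ⟨j, ⟨haj, hj⟩, hmin⟩ := Set.Finite.exists_minimal
      (s := {j : Fin (m + 1) | a.castSucc < j ∧ ∀ k : Fin m, k.castSucc = j → τ₀ k ≤ τ₀ b})
      -- The last point has no slope, so it satisfies the condition vacuously, as if its slope were
      -- minus infinity.
      (Set.toFinite _) ⟨Fin.last m, Fin.castSucc_lt_last a, fun k hk =>
        absurd hk (Fin.castSucc_lt_last k).ne⟩
    have hbj : b.castSucc < j := (Fin.castSucc_lt_castSucc_iff.2 hlt).trans haj
    have heq := hτ b j hbj ((h₀.eq_iff hx b hbj).2 ⟨fun k hbk hkj => ?_, hj⟩)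
    · exact ((h.eq_iff hx b hbj).1 heq).1 a hlt haj
    · rcases le_or_gt k a with hka | hak
      · exact hab k ⟨hbk.le, hka⟩
      · by_contra! h'
        refine (hmin ⟨Fin.castSucc_lt_castSucc_iff.2 hak, fun k' hk' => ?_⟩ hkj.le).not_gt hkj
        rw [Fin.castSucc_injective m hk']
        exact h'.le

/-- Two weights with slope vectors `τ₀` and `τ`: the maximal slopes for the first one are maximal
for the second one iff `τ` is in the cone of the normal fan of the associahedron containing `τ₀`
in its relative interior. -/
theorem IsSlopeVector.forall_eq_iff (h₀ : IsSlopeVector x y₀ τ₀) (h : IsSlopeVector x y τ)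
    (hx : StrictMono x) : (∀ (i : Fin m) (j : Fin (m + 1)), i.castSucc < j →
      y₀ j - y₀ i.castSucc = τ₀ i * (x j - x i.castSucc) →
      y j - y i.castSucc = τ i * (x j - x i.castSucc)) ↔
    ∀ a b, IsMinBetween τ₀ a b → τ b ≤ τ a := by
  refine ⟨fun hτ a b => h₀.isMinBetween_of_eq h hx hτ, fun hτ i j hij heq => ?_⟩
  obtain ⟨h1, h2⟩ := (h₀.eq_iff hx i hij).1 heq
  refine (h.eq_iff hx i hij).2 ⟨fun k hik hkj => hτ k i (isMinBetween_of_gt hik ?_), ?_⟩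
  · intro l hil hlk
    rcases hil.lt_or_eq with hil | rfl
    · exact h1 l hil ((Fin.castSucc_le_castSucc_iff.2 hlk).trans_lt hkj)
    · exact le_rfl
  · rintro k rfl
    have hik := Fin.castSucc_lt_castSucc_iff.1 hij
    refine hτ i k (isMinBetween_of_lt hik fun l hil hlk => ?_)
    rcases hil.lt_or_eq with hil | rfl
    · rcases hlk.lt_or_eq with hlk | rfl
      · exact (h2 k rfl).trans (h1 l hil (Fin.castSucc_lt_castSucc_iff.2 hlk))
      · exact le_rfl
    · exact h2 k rfl

/-- If the maximal slopes are distinct, they are attained once. -/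
theorem IsSlopeVector.unique (h : IsSlopeVector x y τ) (hx : StrictMono x)
    (hτ : Function.Injective τ) (i : Fin m) {j k : Fin (m + 1)} (hj : i.castSucc < j)
    (hk : i.castSucc < k) (hji : y j - y i.castSucc = τ i * (x j - x i.castSucc))
    (hki : y k - y i.castSucc = τ i * (x k - x i.castSucc)) : j = k := by
  wlog hjk : j < k generalizing j k
  · rcases (not_lt.1 hjk).lt_or_eq with h' | h'
    · exact (this hk hj hki hji h').symm
    · exact h'.symm
  obtain ⟨j', rfl⟩ := Fin.exists_castSucc_eq.2 (Fin.ne_last_of_lt hjk)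
  have hij := Fin.castSucc_lt_castSucc_iff.1 hj
  -- Optimality of the nearer target gives `τ j' ≤ τ i`; optimality of the farther one, with `j'` in
  -- between, gives `τ i ≤ τ j'`.
  have h1 := ((h.eq_iff hx i hj).1 hji).2 j' rfl
  have h2 := ((h.eq_iff hx i hk).1 hki).1 j' hij hjk
  exact absurd (hτ (le_antisymm h1 h2)) hij.ne'

/-! ### The slope vector and its inverse -/

/-- The vector of the maximal slopes from each point to the later ones. -/
def slopeVector (x y : Fin (m + 1) → ℝ) : Fin m → ℝ := fun i =>
  (Finset.Ioi i.castSucc).sup' ⟨i.succ, Finset.mem_Ioi.2 Fin.castSucc_lt_succ⟩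
    fun j => (y j - y i.castSucc) / (x j - x i.castSucc)

theorem isSlopeVector_slopeVector (x y : Fin (m + 1) → ℝ) :
    IsSlopeVector x y (slopeVector x y) := fun i => by
  refine ⟨?_, ?_⟩
  · obtain ⟨j, hj, hji⟩ := Finset.exists_mem_eq_sup'
      (⟨i.succ, Finset.mem_Ioi.2 Fin.castSucc_lt_succ⟩ : (Finset.Ioi i.castSucc).Nonempty)
      fun j => (y j - y i.castSucc) / (x j - x i.castSucc)
    exact ⟨j, Finset.mem_Ioi.1 hj, hji.symm⟩
  · rintro _ ⟨j, hj, rfl⟩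
    exact Finset.le_sup' (fun j => (y j - y i.castSucc) / (x j - x i.castSucc))
      (Finset.mem_Ioi.2 hj)

theorem IsSlopeVector.eq_slopeVector (h : IsSlopeVector x y τ) : τ = slopeVector x y :=
  funext fun i => (h i).unique (isSlopeVector_slopeVector x y i)

theorem continuous_slopeVector (x : Fin (m + 1) → ℝ) : Continuous (slopeVector x) := by
  refine continuous_pi fun i => Continuous.finset_sup'_apply _ fun j _ => ?_
  fun_prop

/-- The heights, the last one being zero, with given slope vector. -/
def heightsOfSlopes : (m : ℕ) → (Fin (m + 1) → ℝ) → (Fin m → ℝ) → Fin (m + 1) → ℝ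
  | 0, _, _ => 0
  | m + 1, x, τ => Fin.cons
      -- The smallest height of the first point for which no slope to a later point exceeds `τ 0`;
      -- being the smallest, it makes one of them equal.
      (Finset.univ.sup' Finset.univ_nonempty fun j =>
        heightsOfSlopes m (fun i => x i.succ) (fun i => τ i.succ) j - τ 0 * (x j.succ - x 0))
      (heightsOfSlopes m (fun i => x i.succ) fun i => τ i.succ)

theorem continuous_heightsOfSlopes : ∀ (m : ℕ) (x : Fin (m + 1) → ℝ),
    Continuous (heightsOfSlopes m x)
  | 0, _ => continuous_const
  | m + 1, x => by
    have ih : Continuous fun τ : Fin (m + 1) → ℝ =>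
        heightsOfSlopes m (fun i => x i.succ) fun i => τ i.succ :=
      (continuous_heightsOfSlopes m _).comp (by fun_prop)
    refine Continuous.finCons (Continuous.finset_sup'_apply _ fun j _ => ?_) ih
    have := (continuous_apply j).comp ih
    fun_prop

theorem heightsOfSlopes_last : ∀ (m : ℕ) (x : Fin (m + 1) → ℝ) (τ : Fin m → ℝ),
    heightsOfSlopes m x τ (Fin.last m) = 0
  | 0, _, _ => rfl
  | m + 1, x, τ => by
    rw [heightsOfSlopes, ← Fin.succ_last, Fin.cons_succ, heightsOfSlopes_last]

theorem isSlopeVector_heightsOfSlopes : ∀ (m : ℕ) {x : Fin (m + 1) → ℝ} (_ : StrictMono x)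
    (τ : Fin m → ℝ), IsSlopeVector x (heightsOfSlopes m x τ) τ
  | 0, _, _, _ => fun i => i.elim0
  | m + 1, x, hx, τ => by
    have hx' : StrictMono fun i : Fin (m + 1) => x i.succ :=
      fun i j hij => hx (Fin.succ_lt_succ_iff.2 hij)
    have ih := (isSlopeVector_iff hx').1 (isSlopeVector_heightsOfSlopes m hx' fun i => τ i.succ)
    rw [isSlopeVector_iff hx]
    intro i
    induction i using Fin.cases with
    | zero =>
      simp only [heightsOfSlopes, Fin.castSucc_zero, Fin.cons_zero]
      constructor
      · obtain ⟨j, -, hj⟩ := Finset.exists_mem_eq_sup' (Finset.univ_nonempty (α := Fin (m + 1)))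
          fun j => heightsOfSlopes m (fun i => x i.succ) (fun i => τ i.succ) j -
            τ 0 * (x j.succ - x 0)
        refine ⟨j.succ, Fin.succ_pos j, ?_⟩
        rw [hj, Fin.cons_succ]
        ring
      · intro j hj
        obtain ⟨j, rfl⟩ := Fin.exists_succ_eq.2 hj.ne'
        have := Finset.le_sup' (fun j => heightsOfSlopes m (fun i => x i.succ)
          (fun i => τ i.succ) j - τ 0 * (x j.succ - x 0)) (Finset.mem_univ j)
        rw [Fin.cons_succ]
        linarith
    | succ i =>
      obtain ⟨⟨j, hj, hji⟩, hle⟩ := ih i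
      simp only [heightsOfSlopes, Fin.castSucc_succ, Fin.cons_succ]
      refine ⟨⟨j.succ, Fin.succ_lt_succ_iff.2 hj, ?_⟩, fun k hk => ?_⟩
      · rw [Fin.cons_succ]
        exact hji
      · obtain ⟨k, rfl⟩ := Fin.exists_succ_eq.2 (Fin.pos_of_ne_zero
          (Fin.ne_zero_of_lt hk)).ne'
        rw [Fin.cons_succ]
        exact hle k (Fin.succ_lt_succ_iff.1 hk)

/-- Backwards from the last point, each height is the maximum of `y j - τ i * (x j - x i)` over the
later points, hence determined. -/
theorem IsSlopeVector.eq_of_last_eq {y' : Fin (m + 1) → ℝ} (h : IsSlopeVector x y τ)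
    (h' : IsSlopeVector x y' τ) (hx : StrictMono x)
    (hlast : y (Fin.last m) = y' (Fin.last m)) : y = y' := by
  funext i
  induction i using WellFoundedGT.induction with
  | _ i ih =>
    induction i using Fin.lastCases with
    | last => exact hlast
    | cast i =>
      obtain ⟨j, hj, hji⟩ := h.exists_eq hx i
      obtain ⟨k, hk, hki⟩ := h'.exists_eq hx i
      have h1 := h'.le hx i hj
      have h2 := h.le hx i hk
      rw [ih j hj] at hji
      rw [ih k hk] at h2
      linarith

end Slopes

/-! ### The cones of the pivot fan -/

section PivotFan

variable {ι : Type} [Fintype ι] {P : Set (ι → ℝ)} {c : ι → ℝ}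

theorem slopeOf_add (c ω ω' u v : ι → ℝ) :
    slopeOf c (ω + ω') u v = slopeOf c ω u v + slopeOf c ω' u v := by
  rw [slopeOf, add_dotProduct, add_div, slopeOf, slopeOf]

theorem slopeOf_smul (c : ι → ℝ) (a : ℝ) (ω u v : ι → ℝ) :
    slopeOf c (a • ω) u v = a * slopeOf c ω u v := by
  rw [slopeOf, smul_dotProduct, smul_eq_mul, mul_div_assoc, slopeOf]

theorem slopeOf_zero (c u v : ι → ℝ) : slopeOf c 0 u v = 0 := by
  rw [slopeOf, zero_dotProduct, zero_div]

/-- The slope, as a linear functional of the weight. -/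
def slopeFunctional (c u v : ι → ℝ) : StrongDual ℝ (ι → ℝ) :=
  LinearMap.toContinuousLinearMap
    { toFun := fun ω => slopeOf c ω u v
      map_add' := fun ω ω' => slopeOf_add c ω ω' u v
      map_smul' := fun a ω => slopeOf_smul c a ω u v }

@[simp] theorem slopeFunctional_apply (c u v ω : ι → ℝ) :
    slopeFunctional c u v ω = slopeOf c ω u v := rfl

/-- The improving neighbors of `u` of maximal slope. -/
def optimalNeighbors (P : Set (ι → ℝ)) (c ω u : ι → ℝ) : Set (ι → ℝ) :=
  {v ∈ improvingNeighbors P c u | ∀ v' ∈ improvingNeighbors P c u,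
    slopeOf c ω u v' ≤ slopeOf c ω u v}

/-- The cone of the pivot fan that has `ω₀` in its relative interior. -/
def pivotCone (P : Set (ι → ℝ)) (c ω₀ : ι → ℝ) : Set (ι → ℝ) :=
  {ω | ∀ u ∈ P.extremePoints ℝ, optimalNeighbors P c ω₀ u ⊆ optimalNeighbors P c ω u}

theorem self_mem_pivotCone (ω₀ : ι → ℝ) : ω₀ ∈ pivotCone P c ω₀ := fun _ _ => subset_rfl

theorem zero_mem_pivotCone (ω₀ : ι → ℝ) : 0 ∈ pivotCone P c ω₀ := fun u _ v hv =>
  ⟨hv.1, fun v' _ => by rw [slopeOf_zero, slopeOf_zero]⟩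

theorem add_mem_pivotCone {ω₀ ω ω' : ι → ℝ} (h : ω ∈ pivotCone P c ω₀)
    (h' : ω' ∈ pivotCone P c ω₀) : ω + ω' ∈ pivotCone P c ω₀ := fun u hu v hv =>
  ⟨hv.1, fun v' hv' => by
    rw [slopeOf_add, slopeOf_add]
    exact add_le_add ((h u hu hv).2 v' hv') ((h' u hu hv).2 v' hv')⟩

theorem pivotCone_subset {ω₀ ω₁ : ι → ℝ} (h : ω₀ ∈ pivotCone P c ω₁) :
    pivotCone P c ω₀ ⊆ pivotCone P c ω₁ := fun _ hω u hu => (h u hu).trans (hω u hu)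

theorem slopeOf_eq_of_mem_optimalNeighbors {ω u v v' : ι → ℝ}
    (h : v ∈ optimalNeighbors P c ω u) (h' : v' ∈ optimalNeighbors P c ω u) :
    slopeOf c ω u v = slopeOf c ω u v' :=
  le_antisymm (h'.2 v h.1) (h.2 v' h'.1)

theorem mem_optimalNeighbors_of_le {ω u v v' : ι → ℝ} (h : v ∈ optimalNeighbors P c ω u)
    (hv' : v' ∈ improvingNeighbors P c u) (hle : slopeOf c ω u v ≤ slopeOf c ω u v') :
    v' ∈ optimalNeighbors P c ω u :=
  ⟨hv', fun w hw => (h.2 w hw).trans hle⟩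

theorem optimalNeighbors_nonempty {u : ι → ℝ} (hfin : (improvingNeighbors P c u).Finite)
    (hne : (improvingNeighbors P c u).Nonempty) (ω : ι → ℝ) :
    (optimalNeighbors P c ω u).Nonempty := by
  obtain ⟨v, hv, hmax⟩ := Set.exists_max_image _ (slopeOf c ω u) hfin hne
  exact ⟨v, hv, hmax⟩

theorem isClosed_pivotCone (ω₀ : ι → ℝ) : IsClosed (pivotCone P c ω₀) := by
  have : pivotCone P c ω₀ = ⋂ u ∈ P.extremePoints ℝ, ⋂ v ∈ optimalNeighbors P c ω₀ u,
      ⋂ v' ∈ improvingNeighbors P c u,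
        {ω | slopeFunctional c u v' ω ≤ slopeFunctional c u v ω} := by
    ext ω
    simp only [Set.mem_iInter, Set.mem_ofPred_eq, slopeFunctional_apply]
    exact ⟨fun h u hu v hv => (h u hu hv).2, fun h u hu v hv => ⟨hv.1, h u hu v hv⟩⟩
  rw [this]
  exact isClosed_biInter fun u _ => isClosed_biInter fun v _ => isClosed_biInter fun v' _ =>
    isClosed_le (slopeFunctional c u v').continuous (slopeFunctional c u v).continuous

theorem IsArborescenceOf.eq_of_mem {ω : ι → ℝ} {A : P.extremePoints ℝ → P.extremePoints ℝ}
    (h : IsArborescenceOf P c ω A) {u : P.extremePoints ℝ} {v : ι → ℝ}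
    (hv : v ∈ optimalNeighbors P c ω u) : v = A u := by
  by_contra hne
  obtain ⟨h1, h2⟩ := (h u).1 ⟨v, hv.1⟩
  exact (h2 v hv.1 hne).not_ge (hv.2 _ h1)

theorem IsArborescenceOf.mem {ω : ι → ℝ} {A : P.extremePoints ℝ → P.extremePoints ℝ}
    (h : IsArborescenceOf P c ω A) {u : P.extremePoints ℝ}
    (hne : (improvingNeighbors P c u).Nonempty) : (A u : ι → ℝ) ∈ optimalNeighbors P c ω u := by
  obtain ⟨h1, h2⟩ := (h u).1 hne
  refine ⟨h1, fun v hv => ?_⟩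
  rcases eq_or_ne v (A u) with rfl | hva
  exacts [le_rfl, (h2 v hv hva).le]

/-- The maximal cones of the pivot fan. -/
theorem IsArborescenceOf.closure_eq {ω₁ : ι → ℝ} {A : P.extremePoints ℝ → P.extremePoints ℝ}
    (h : IsArborescenceOf P c ω₁ A) :
    closure {ω | IsArborescenceOf P c ω A} = pivotCone P c ω₁ := by
  apply subset_antisymm
  · refine closure_minimal (fun ω hω u hu v hv => ?_) (isClosed_pivotCone ω₁)
    obtain rfl : v = A ⟨u, hu⟩ := h.eq_of_mem (u := ⟨u, hu⟩) hv
    exact hω.mem (u := ⟨u, hu⟩) ⟨_, hv.1⟩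
  · intro ω hω
    -- Adding a small positive multiple of `ω₁` makes the weak inequalities satisfied by `ω` strict.
    have hlim : Filter.Tendsto (fun ε : ℝ => ω + ε • ω₁) (nhdsWithin 0 (Set.Ioi 0))
        (nhds ω) := by
      have : Continuous fun ε : ℝ => ω + ε • ω₁ := by fun_prop
      simpa using (this.tendsto 0).mono_left nhdsWithin_le_nhds
    refine mem_closure_of_tendsto hlim ?_
    filter_upwards [self_mem_nhdsWithin] with ε hε u
    refine ⟨fun hne => ⟨((h u).1 hne).1, fun v hv hva => ?_⟩, (h u).2⟩
    have h1 := ((h u).1 hne).2 v hv hva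
    have h2 := (hω u u.2 (h.mem hne)).2 v hv
    simp only [slopeOf_add, slopeOf_smul]
    exact add_lt_add_of_le_of_lt h2 (mul_lt_mul_of_pos_left h1 hε)

/-- The exposing functional sums `slope(u, v) - slope(u, a)` over all `v` optimal for `ω₀` and `a`
optimal for `ω₁` at `u`. On the larger cone each term is nonpositive, and it vanishes iff `v` is
optimal too. -/
theorem isExposed_pivotCone (hfin : (P.extremePoints ℝ).Finite)
    (hIN : ∀ u ∈ P.extremePoints ℝ, improvingNeighbors P c u ⊆ P.extremePoints ℝ)
    {ω₀ ω₁ : ι → ℝ} (h : ω₀ ∈ pivotCone P c ω₁) :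
    IsExposed ℝ (pivotCone P c ω₁) (pivotCone P c ω₀) := by
  classical
  intro _
  let T : Finset ((ι → ℝ) × (ι → ℝ) × (ι → ℝ)) :=
    (hfin.toFinset ×ˢ hfin.toFinset ×ˢ hfin.toFinset).filter fun q =>
      q.2.1 ∈ optimalNeighbors P c ω₀ q.1 ∧ q.2.2 ∈ optimalNeighbors P c ω₁ q.1
  have hT : ∀ q, q ∈ T ↔ q.1 ∈ P.extremePoints ℝ ∧ q.2.1 ∈ optimalNeighbors P c ω₀ q.1 ∧
      q.2.2 ∈ optimalNeighbors P c ω₁ q.1 := by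
    intro q
    simp only [T, Finset.mem_filter, Finset.mem_product, Set.Finite.mem_toFinset]
    exact ⟨fun h => ⟨h.1.1, h.2⟩, fun h =>
      ⟨⟨h.1, hIN _ h.1 h.2.1.1, hIN _ h.1 h.2.2.1⟩, h.2⟩⟩
  let l : StrongDual ℝ (ι → ℝ) :=
    ∑ q ∈ T, (slopeFunctional c q.1 q.2.1 - slopeFunctional c q.1 q.2.2)
  have hl : ∀ ω, l ω = ∑ q ∈ T, (slopeOf c ω q.1 q.2.1 - slopeOf c ω q.1 q.2.2) := by
    intro ω
    simp [l]
  have hnonpos : ∀ ω ∈ pivotCone P c ω₁, ∀ q ∈ T,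
      slopeOf c ω q.1 q.2.1 - slopeOf c ω q.1 q.2.2 ≤ 0 := fun ω hω q hq => by
    obtain ⟨h1, h2, h3⟩ := (hT q).1 hq
    exact sub_nonpos.2 ((hω _ h1 h3).2 _ h2.1)
  refine ⟨l, Set.Subset.antisymm ?_ ?_⟩
  · refine fun ω hω => ⟨pivotCone_subset h hω, fun ω' hω' => ?_⟩
    have : l ω = 0 := by
      rw [hl]
      refine Finset.sum_eq_zero fun q hq => ?_
      obtain ⟨h1, h2, h3⟩ := (hT q).1 hq
      exact sub_eq_zero.2 (slopeOf_eq_of_mem_optimalNeighbors (hω _ h1 h2)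
        (pivotCone_subset h hω _ h1 h3))
    rw [this, hl]
    exact Finset.sum_nonpos (hnonpos ω' hω')
  · rintro ω ⟨hω, hmax⟩ u hu v hv
    have h0 : l ω = 0 := by
      refine le_antisymm ?_ (by simpa using hmax 0 (zero_mem_pivotCone ω₁))
      rw [hl]
      exact Finset.sum_nonpos (hnonpos ω hω)
    rw [hl, Finset.sum_eq_zero_iff_of_nonpos (hnonpos ω hω)] at h0
    obtain ⟨a, ha⟩ := optimalNeighbors_nonempty (hfin.subset (hIN u hu)) ⟨v, hv.1⟩ ω₁
    have := h0 (u, v, a) ((hT _).2 ⟨hu, hv, ha⟩)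
    exact mem_optimalNeighbors_of_le (hω u hu ha) hv.1 (sub_eq_zero.1 this).ge

/-- A relative interior point of the face is found combinatorially: a weight `ω₀` of `D` whose
finite set of optimal pairs (vertex, neighbor) is minimal. -/
theorem exists_eq_pivotCone_of_isExposed (hfin : (P.extremePoints ℝ).Finite)
    (hIN : ∀ u ∈ P.extremePoints ℝ, improvingNeighbors P c u ⊆ P.extremePoints ℝ)
    {ω₁ : ι → ℝ} {D : Set (ι → ℝ)} (hD : IsExposed ℝ (pivotCone P c ω₁) D)
    (hne : D.Nonempty) : ∃ ω₀, D = pivotCone P c ω₀ := by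
  obtain ⟨l, hl⟩ := hD hne
  have hl0 : ∀ ω ∈ D, l ω = 0 := by
    intro ω hω
    rw [hl] at hω
    have h1 := hω.2 0 (zero_mem_pivotCone ω₁)
    -- Comparing with `0` and with the double of `ω` forces the maximum on the cone to be zero.
    have h2 := hω.2 (ω + ω) (add_mem_pivotCone hω.1 hω.1)
    simp only [map_zero, map_add] at h1 h2
    linarith
  have hlC : ∀ ω ∈ pivotCone P c ω₁, l ω ≤ 0 := by
    obtain ⟨ω, hω⟩ := hne
    have := hl0 ω hω
    rw [hl] at hω
    exact fun ω' hω' => (hω.2 ω' hω').trans this.le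
  have hmemD : ∀ ω ∈ pivotCone P c ω₁, 0 ≤ l ω → ω ∈ D := fun ω hω h => by
    rw [hl]
    exact ⟨hω, fun ω' hω' => (hlC ω' hω').trans h⟩
  have hDC : D ⊆ pivotCone P c ω₁ := hD.subset
  let O : (ι → ℝ) → Set ((ι → ℝ) × (ι → ℝ)) := fun ω =>
    {q | q.1 ∈ P.extremePoints ℝ ∧ q.2 ∈ optimalNeighbors P c ω q.1}
  have hO : (O '' D).Finite := by
    refine ((hfin.prod hfin).powerset).subset ?_
    rintro _ ⟨ω, -, rfl⟩ q hq
    exact ⟨hq.1, hIN _ hq.1 hq.2.1⟩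
  obtain ⟨_, ⟨ω₀, hω₀, rfl⟩, hmin⟩ := hO.exists_minimal (hne.image O)
  refine ⟨ω₀, subset_antisymm (fun ω hω u hu v hv => ?_) fun ω hω => ?_⟩
  · have hsum : ω₀ + ω ∈ D := hmemD _ (add_mem_pivotCone (hDC hω₀) (hDC hω)) (by
      rw [map_add, hl0 ω₀ hω₀, hl0 ω hω, add_zero])
    have hsub : ∀ q ∈ O (ω₀ + ω), q ∈ O ω₀ ∧ q ∈ O ω := by
      rintro ⟨u, v⟩ ⟨hu, hv⟩
      -- A neighbor `a` optimal for `ω₁` is optimal for both summands; a `v` optimal for the sum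
      -- must then tie with `a` for each of them.
      obtain ⟨a, ha⟩ := optimalNeighbors_nonempty (hfin.subset (hIN u hu)) ⟨v, hv.1⟩ ω₁
      have h1 := hDC hω₀ u hu ha
      have h2 := hDC hω u hu ha
      have h3 := hv.2 a ha.1
      have h4 := h1.2 v hv.1
      have h5 := h2.2 v hv.1
      simp only [slopeOf_add] at h3 h4 h5
      exact ⟨⟨hu, mem_optimalNeighbors_of_le h1 hv.1 (by linarith)⟩,
        ⟨hu, mem_optimalNeighbors_of_le h2 hv.1 (by linarith)⟩⟩
    have := hmin (Set.mem_image_of_mem O hsum) (fun q hq => (hsub q hq).1)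
    exact (hsub (u, v) (this (show (u, v) ∈ O ω₀ from ⟨hu, hv⟩))).2.2
  · have hωC := pivotCone_subset (hDC hω₀) hω
    -- Since `l` vanishes at `ω₀` and is nonpositive on the cone, staying in the cone in direction
    -- `-ω` forces `l ω ≥ 0`. Ties for `ω₀` are ties for `ω`, and strict inequalities survive small
    -- `ε`.
    have hev : ∀ᶠ ε : ℝ in nhdsWithin 0 (Set.Ioi 0), ω₀ - ε • ω ∈ pivotCone P c ω₁ := by
      have : ∀ᶠ ε : ℝ in nhdsWithin 0 (Set.Ioi 0), ∀ u ∈ P.extremePoints ℝ,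
          ∀ a ∈ P.extremePoints ℝ, ∀ v ∈ P.extremePoints ℝ,
          a ∈ optimalNeighbors P c ω₁ u → v ∈ improvingNeighbors P c u →
            slopeOf c (ω₀ - ε • ω) u v ≤ slopeOf c (ω₀ - ε • ω) u a := by
        refine (Filter.eventually_all_finite hfin).2 fun u hu =>
          (Filter.eventually_all_finite hfin).2 fun a _ =>
          (Filter.eventually_all_finite hfin).2 fun v _ => ?_
        by_cases ha : a ∈ optimalNeighbors P c ω₁ u
        swap
        · exact .of_forall fun ε h => absurd h ha
        by_cases hv : v ∈ improvingNeighbors P c u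
        swap
        · exact .of_forall fun ε _ h => absurd h hv
        have ha₀ := hDC hω₀ u hu ha
        have hexp : ∀ ε : ℝ, ∀ w, slopeOf c (ω₀ - ε • ω) u w =
            slopeOf c ω₀ u w - ε * slopeOf c ω u w := fun ε w => by
          simp only [← slopeFunctional_apply, map_sub, map_smul, smul_eq_mul]
        by_cases hv₀ : v ∈ optimalNeighbors P c ω₀ u
        · refine .of_forall fun ε _ _ => ?_
          rw [hexp, hexp, slopeOf_eq_of_mem_optimalNeighbors ha₀ hv₀,
            slopeOf_eq_of_mem_optimalNeighbors (hω u hu ha₀) (hω u hu hv₀)]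
        · have hlt : slopeOf c ω₀ u v < slopeOf c ω₀ u a := by
            by_contra! hle
            exact hv₀ (mem_optimalNeighbors_of_le ha₀ hv hle)
          have hcont : ∀ w, Continuous fun ε : ℝ => slopeOf c (ω₀ - ε • ω) u w := fun w => by
            simp only [hexp]
            fun_prop
          have := (hcont v).continuousAt.eventually_lt (hcont a).continuousAt
            (x₀ := 0) (by simpa using hlt)
          exact (this.filter_mono nhdsWithin_le_nhds).mono fun ε h _ _ => h.le
      filter_upwards [this] with ε hε u hu a ha
      exact ⟨ha.1, fun v hv => hε u hu a (hIN u hu ha.1) v (hIN u hu hv) ha hv⟩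
    obtain ⟨ε, hε, hε0⟩ := (hev.and self_mem_nhdsWithin).exists
    refine hmemD ω hωC ?_
    have := hlC _ hε
    rw [map_sub, map_smul, hl0 ω₀ hω₀, smul_eq_mul, zero_sub, neg_nonpos] at this
    exact nonneg_of_mul_nonneg_right this hε0

theorem exists_isArborescenceOf (hfin : (P.extremePoints ℝ).Finite)
    (hIN : ∀ u ∈ P.extremePoints ℝ, improvingNeighbors P c u ⊆ P.extremePoints ℝ)
    {ω : ι → ℝ} (h : ∀ u ∈ P.extremePoints ℝ, (optimalNeighbors P c ω u).Subsingleton) :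
    ∃ A, IsArborescenceOf P c ω A := by
  have : ∀ u : P.extremePoints ℝ, ∃ a : P.extremePoints ℝ,
      ((improvingNeighbors P c u).Nonempty →
        (a : ι → ℝ) ∈ improvingNeighbors P c u ∧
          ∀ v ∈ improvingNeighbors P c u, v ≠ a → slopeOf c ω u v < slopeOf c ω u a) ∧
      (improvingNeighbors P c u = ∅ → a = u) := by
    intro u
    rcases Set.eq_empty_or_nonempty (improvingNeighbors P c u) with he | hne
    · exact ⟨u, fun h => absurd he h.ne_empty, fun _ => rfl⟩
    · obtain ⟨a, ha⟩ := optimalNeighbors_nonempty (hfin.subset (hIN u u.2)) hne ω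
      refine ⟨⟨a, hIN u u.2 ha.1⟩, fun _ => ⟨ha.1, fun v hv hva => ?_⟩,
        fun he => absurd he hne.ne_empty⟩
      by_contra! hle
      exact hva (h u u.2 (mem_optimalNeighbors_of_le ha hv hle) ha)
  choose A hA using this
  exact ⟨A, hA⟩

/-- Maximal cones are those of generic weights, and their faces are again pivot cones. By `hgen`
every weight lies in the cone of a generic one, so that no pivot cone is missed. -/
theorem pivotFan_eq_range (hfin : (P.extremePoints ℝ).Finite)
    (hIN : ∀ u ∈ P.extremePoints ℝ, improvingNeighbors P c u ⊆ P.extremePoints ℝ)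
    (hgen : ∀ ω₀, ∃ ω₁, ω₀ ∈ pivotCone P c ω₁ ∧
      ∀ u ∈ P.extremePoints ℝ, (optimalNeighbors P c ω₁ u).Subsingleton) :
    pivotFan P c = Set.range (pivotCone P c) := by
  ext D
  constructor
  · rintro ⟨_, ⟨A, ⟨ω₁, hω₁⟩, rfl⟩, hD, hne⟩
    rw [hω₁.closure_eq] at hD
    obtain ⟨ω₀, rfl⟩ := exists_eq_pivotCone_of_isExposed hfin hIN hD hne
    exact ⟨ω₀, rfl⟩
  · rintro ⟨ω₀, rfl⟩
    obtain ⟨ω₁, h, hω₁⟩ := hgen ω₀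
    obtain ⟨A, hA⟩ := exists_isArborescenceOf hfin hIN hω₁
    refine ⟨_, ⟨A, ⟨ω₁, hA⟩, rfl⟩, ?_, ω₀, self_mem_pivotCone ω₀⟩
    rw [hA.closure_eq]
    exact isExposed_pivotCone hfin hIN h

end PivotFan

/-! ### Edges of simplices and of products of simplices -/

section Edges

theorem mem_extremePoints_segment {E : Type*} [AddCommGroup E] [Module ℝ E] (u v : E) : u ∈ (segment ℝ u v).extremePoints ℝ := by
  rcases eq_or_ne u v with rfl | huv
  · simp
  refine mem_extremePoints_iff_left.2 ⟨left_mem_segment ℝ u v, fun x hx y hy hu => ?_⟩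
  rw [segment_eq_image'] at hx hy
  obtain ⟨a, ha, rfl⟩ := hx
  obtain ⟨b, hb, rfl⟩ := hy
  obtain ⟨r, s, hr, hs, hrs, h⟩ := hu
  have h0 : (r * a + s * b) • (v - u) = 0 := by
    have : r • (u + a • (v - u)) + s • (u + b • (v - u)) =
        (r + s) • u + (r * a + s * b) • (v - u) := by module
    simp only [this, hrs, one_smul] at h
    simpa using h
  have h1 : r * a + s * b = 0 := (smul_eq_zero.1 h0).resolve_right (sub_ne_zero.2 huv.symm)
  have h2 : a = 0 := by
    have := mul_nonneg hs.le hb.1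
    have := mul_nonneg hr.le ha.1
    exact (mul_eq_zero.1 (by linarith : r * a = 0)).resolve_left hr.ne'
  simp [h2]

theorem IsEdge.right_mem {ι : Type} {P : Set (ι → ℝ)} {u v : ι → ℝ} (h : IsEdge P u v) :
    v ∈ P.extremePoints ℝ := by
  refine h.2.isExtreme.extremePoints_subset_extremePoints ?_
  rw [segment_symm]
  exact mem_extremePoints_segment v u

variable {ι : Type} [Fintype ι] {κ : Type*}

theorem maxFace_range_eq_image {v : κ → ι → ℝ} {w : ι → ℝ} {J : Set κ}
    (hJ : ∀ k, (∀ l, w ⬝ᵥ v l ≤ w ⬝ᵥ v k) ↔ k ∈ J) : maxFace (Set.range v) w = v '' J := by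
  ext x
  constructor
  · rintro ⟨⟨k, rfl⟩, hk⟩
    exact ⟨k, (hJ k).1 fun l => hk _ ⟨l, rfl⟩, rfl⟩
  · rintro ⟨k, hk, rfl⟩
    refine ⟨⟨k, rfl⟩, ?_⟩
    rintro _ ⟨l, rfl⟩
    exact (hJ k).2 hk l

theorem isExposed_convexHull_image {v : κ → ι → ℝ} {w : ι → ℝ} {J : Set κ}
    (hJ : ∀ k, (∀ l, w ⬝ᵥ v l ≤ w ⬝ᵥ v k) ↔ k ∈ J) :
    IsExposed ℝ (convexHull ℝ (Set.range v)) (convexHull ℝ (v '' J)) := by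
  rw [← maxFace_range_eq_image hJ, ← maxFace_convexHull]
  exact isExposed_maxFace _ w

theorem isEdge_convexHull_range {v : κ → ι → ℝ} {w : ι → ℝ} {a b : κ} (hab : v a ≠ v b)
    (h : ∀ k, (∀ l, w ⬝ᵥ v l ≤ w ⬝ᵥ v k) ↔ k = a ∨ k = b) :
    IsEdge (convexHull ℝ (Set.range v)) (v a) (v b) := by
  have := isExposed_convexHull_image (J := {a, b}) h
  rw [Set.image_pair, convexHull_pair] at this
  exact ⟨hab, this⟩

theorem mem_extremePoints_convexHull_range {v : κ → ι → ℝ} {w : ι → ℝ} {a : κ}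
    (h : ∀ k, (∀ l, w ⬝ᵥ v l ≤ w ⬝ᵥ v k) ↔ k = a) :
    v a ∈ (convexHull ℝ (Set.range v)).extremePoints ℝ := by
  have := (isExposed_convexHull_image (J := {a}) h).isExtreme
  rwa [Set.image_singleton, convexHull_singleton, isExtreme_singleton] at this

theorem improvingNeighbors_subset_extremePoints (P : Set (ι → ℝ)) (c u : ι → ℝ) :
    improvingNeighbors P c u ⊆ P.extremePoints ℝ := fun _ hv => hv.1.right_mem

end Edges

/-! ### Weights, edges and slopes on one simplex. -/

section Simplex

variable {m : ℕ} {q : Fin (m + 1) → Fin m → ℝ}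

/-- The differences of the values of a weight at the vertices of a full-dimensional simplex and
its value at the last vertex. -/
def vertexValues (q : Fin (m + 1) → Fin m → ℝ) : (Fin m → ℝ) →ₗ[ℝ] Fin m → ℝ where
  toFun ω := fun i => ω ⬝ᵥ (q i.castSucc - q (Fin.last m))
  map_add' _ _ := funext fun _ => add_dotProduct _ _ _
  map_smul' _ _ := funext fun _ => smul_dotProduct _ _ _

theorem vertexValues_apply (ω : Fin m → ℝ) (i : Fin m) :
    vertexValues q ω i = ω ⬝ᵥ q i.castSucc - ω ⬝ᵥ q (Fin.last m) :=
  dotProduct_sub ω (q i.castSucc) (q (Fin.last m))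

/-- The differences with the last vertex span the whole space, by full-dimensionality. -/
theorem vertexValues_injective (hq : AffineIndependent ℝ q) :
    Function.Injective (vertexValues q) := by
  rw [← LinearMap.ker_eq_bot, LinearMap.ker_eq_bot']
  intro ω hω
  have hspan := hq.vectorSpan_eq_top_of_card_eq_finrank_add_one (by simp)
  rw [vectorSpan_range_eq_span_range_vsub_right ℝ q (Fin.last m)] at hspan
  have h0 : ∀ v, ω ⬝ᵥ v = 0 := by
    intro v
    have hv : v ∈ Submodule.span ℝ (Set.range fun i => q i -ᵥ q (Fin.last m)) := by
      rw [hspan]; trivial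
    induction hv using Submodule.span_induction with
    | mem x hx =>
      obtain ⟨i, rfl⟩ := hx
      induction i using Fin.lastCases with
      | last => simp
      | cast i => exact congrFun hω i
    | zero => simp
    | add x y _ _ hx hy => rw [dotProduct_add, hx, hy, add_zero]
    | smul a x _ hx => rw [dotProduct_smul, hx, smul_zero]
  exact dotProduct_eq_zero ω h0

/-- Weights correspond to their values at the vertices of a simplex, up to translation. -/
def vertexValuesEquiv (hq : AffineIndependent ℝ q) : (Fin m → ℝ) ≃L[ℝ] Fin m → ℝ :=
  (LinearEquiv.ofInjectiveEndo (vertexValues q) (vertexValues_injective hq)).toContinuousLinearEquiv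

theorem vertexValuesEquiv_apply (hq : AffineIndependent ℝ q) (ω : Fin m → ℝ) (i : Fin m) :
    vertexValuesEquiv hq ω i = ω ⬝ᵥ q i.castSucc - ω ⬝ᵥ q (Fin.last m) :=
  vertexValues_apply ω i

theorem exists_dotProduct_vertex_eq (hq : AffineIndependent ℝ q) (y : Fin (m + 1) → ℝ) :
    ∃ ω a, ∀ i, ω ⬝ᵥ q i = y i + a := by
  let ω := (vertexValuesEquiv hq).symm fun i => y i.castSucc - y (Fin.last m)
  refine ⟨ω, ω ⬝ᵥ q (Fin.last m) - y (Fin.last m), fun i => ?_⟩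
  induction i using Fin.lastCases with
  | last => ring
  | cast i =>
    have := vertexValuesEquiv_apply hq ω i
    rw [ContinuousLinearEquiv.apply_symm_apply] at this
    linarith

theorem isEdge_simplex (hq : AffineIndependent ℝ q) {i j : Fin (m + 1)} (hij : i ≠ j) :
    IsEdge (convexHull ℝ (Set.range q)) (q i) (q j) := by
  -- Values at the vertices of a simplex are arbitrary up to a constant, so any set of vertices can
  -- be made the maximal one.
  obtain ⟨ω, a, hω⟩ := exists_dotProduct_vertex_eq hq fun k => if k = i ∨ k = j then 1 else 0
  refine isEdge_convexHull_range (w := ω) (hq.injective.ne hij) fun k => ?_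
  simp only [hω, add_le_add_iff_right]
  constructor
  · intro h
    by_contra hk
    have := h i
    simp only [true_or, if_true, if_neg hk] at this
    norm_num at this
  · intro hk l
    rw [if_pos hk]
    split_ifs <;> norm_num

theorem improvingNeighbors_simplex (hq : AffineIndependent ℝ q) {c : Fin m → ℝ}
    (hc : StrictMono fun i => c ⬝ᵥ q i) (i : Fin (m + 1)) :
    improvingNeighbors (convexHull ℝ (Set.range q)) c (q i) = q '' Set.Ioi i := by
  ext v
  constructor
  · rintro ⟨hv, hlt⟩
    obtain ⟨j, rfl⟩ := extremePoints_convexHull_subset hv.right_mem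
    exact ⟨j, hc.lt_iff_lt.1 hlt, rfl⟩
  · rintro ⟨j, hj, rfl⟩
    exact ⟨isEdge_simplex hq (Set.mem_Ioi.1 hj).ne, hc hj⟩

/-- The slope map of a full-dimensional simplex with vertices sorted by `σ`. -/
theorem slopeMap_eq {p : Fin (m + 1) → Fin m → ℝ} (hp : AffineIndependent ℝ p) {c : Fin m → ℝ}
    (hc : StrictMono fun i => c ⬝ᵥ p (Tuple.sort (fun j => c ⬝ᵥ p j) i)) (ω : Fin m → ℝ) :
    slopeMap p c ω = slopeVector (fun i => c ⬝ᵥ p (Tuple.sort (fun j => c ⬝ᵥ p j) i))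
      fun i => ω ⬝ᵥ p (Tuple.sort (fun j => c ⬝ᵥ p j) i) := by
  set σ := Tuple.sort fun j => c ⬝ᵥ p j with hσ
  have hq : AffineIndependent ℝ (p ∘ σ) := hp.comp_embedding σ.toEmbedding
  refine IsSlopeVector.eq_slopeVector fun i => ?_
  have hrange : Set.range p = Set.range (p ∘ σ) := (σ.surjective.range_comp p).symm
  have heq : slopeMap p c ω i = sSup ((fun j => (ω ⬝ᵥ p (σ j) - ω ⬝ᵥ p (σ i.castSucc)) /
      (c ⬝ᵥ p (σ j) - c ⬝ᵥ p (σ i.castSucc))) '' Set.Ioi i.castSucc) := by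
    have := improvingNeighbors_simplex hq hc i.castSucc
    simp only [slopeMap, optimalSlope, hrange]
    simp only [Function.comp_apply] at this
    rw [← hσ, this, Set.image_image]
    simp only [slopeOf, dotProduct_sub]
  rw [heq]
  have := isSlopeVector_slopeVector (fun i => c ⬝ᵥ p (σ i)) (fun i => ω ⬝ᵥ p (σ i)) i
  rwa [this.csSup_eq]

theorem slopeVector_add_const (x y : Fin (m + 1) → ℝ) (a : ℝ) :
    slopeVector x (fun i => y i + a) = slopeVector x y := by
  funext i
  simp only [slopeVector, add_sub_add_right_eq_sub]

/-- The weight on a full-dimensional simplex with given optimal slopes. -/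
def weightOfSlopes (hq : AffineIndependent ℝ q) (x : Fin (m + 1) → ℝ) (τ : Fin m → ℝ) :
    Fin m → ℝ :=
  (vertexValuesEquiv hq).symm fun i => heightsOfSlopes m x τ i.castSucc

theorem continuous_weightOfSlopes (hq : AffineIndependent ℝ q) (x : Fin (m + 1) → ℝ) :
    Continuous (weightOfSlopes hq x) := by
  refine (vertexValuesEquiv hq).symm.continuous.comp (continuous_pi fun i => ?_)
  exact (continuous_apply _).comp (continuous_heightsOfSlopes m x)

theorem weightOfSlopes_dotProduct (hq : AffineIndependent ℝ q) (x : Fin (m + 1) → ℝ)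
    (τ : Fin m → ℝ) (i : Fin (m + 1)) : weightOfSlopes hq x τ ⬝ᵥ q i =
      heightsOfSlopes m x τ i + weightOfSlopes hq x τ ⬝ᵥ q (Fin.last m) := by
  induction i using Fin.lastCases with
  | last => rw [heightsOfSlopes_last, zero_add]
  | cast i =>
    have := vertexValuesEquiv_apply hq (weightOfSlopes hq x τ) i
    rw [weightOfSlopes, ContinuousLinearEquiv.apply_symm_apply, ← weightOfSlopes] at this
    linarith

theorem slopeVector_weightOfSlopes (hq : AffineIndependent ℝ q) {x : Fin (m + 1) → ℝ}
    (hx : StrictMono x) (τ : Fin m → ℝ) :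
    (slopeVector x fun i => weightOfSlopes hq x τ ⬝ᵥ q i) = τ := by
  rw [funext (weightOfSlopes_dotProduct hq x τ), slopeVector_add_const]
  exact (isSlopeVector_heightsOfSlopes m hx τ).eq_slopeVector.symm

theorem weightOfSlopes_slopeVector (hq : AffineIndependent ℝ q) {x : Fin (m + 1) → ℝ}
    (hx : StrictMono x) (ω : Fin m → ℝ) :
    weightOfSlopes hq x (slopeVector x fun i => ω ⬝ᵥ q i) = ω := by
  rw [weightOfSlopes, ContinuousLinearEquiv.symm_apply_eq]
  -- Slopes ignore a common translation of the heights; this one makes the last height zero, as for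
  -- `heightsOfSlopes`.
  have h : slopeVector x (fun i => ω ⬝ᵥ q i) =
      slopeVector x fun i => ω ⬝ᵥ q i + -(ω ⬝ᵥ q (Fin.last m)) :=
    (slopeVector_add_const _ _ _).symm
  have key := (isSlopeVector_heightsOfSlopes m hx
    (slopeVector x fun i => ω ⬝ᵥ q i)).eq_of_last_eq (h ▸ isSlopeVector_slopeVector x
      fun i => ω ⬝ᵥ q i + -(ω ⬝ᵥ q (Fin.last m))) hx (by
        rw [heightsOfSlopes_last, add_neg_cancel])
  funext i
  rw [vertexValuesEquiv_apply, key, sub_eq_add_neg]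

end Simplex

/-! ### Vertices, edges and improving neighbors of a product of simplices. -/

section Product

variable {t : ℕ} {m : Fin t → ℕ} {q : (s : Fin t) → Fin (m s + 1) → Fin (m s) → ℝ}

/-- The vertices of a product of simplices. -/
def productVertex (q : (s : Fin t) → Fin (m s + 1) → Fin (m s) → ℝ)
    (f : (s : Fin t) → Fin (m s + 1)) : ((s : Fin t) × Fin (m s)) → ℝ :=
  fun k => q k.1 (f k.1) k.2

theorem dotProduct_eq_sum_block (w x : ((s : Fin t) × Fin (m s)) → ℝ) :
    w ⬝ᵥ x = ∑ s, block w s ⬝ᵥ block x s := by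
  simp only [dotProduct, Fintype.sum_sigma, block]

theorem dotProduct_productVertex (w : ((s : Fin t) × Fin (m s)) → ℝ)
    (f : (s : Fin t) → Fin (m s + 1)) :
    w ⬝ᵥ productVertex q f = ∑ s, block w s ⬝ᵥ q s (f s) :=
  dotProduct_eq_sum_block _ _

theorem dotProduct_productVertex_update (w : ((s : Fin t) × Fin (m s)) → ℝ)
    (f : (s : Fin t) → Fin (m s + 1)) (s : Fin t) (j : Fin (m s + 1)) :
    w ⬝ᵥ (productVertex q (Function.update f s j) - productVertex q f) =
      block w s ⬝ᵥ q s j - block w s ⬝ᵥ q s (f s) := by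
  rw [dotProduct_sub, dotProduct_productVertex, dotProduct_productVertex,
    ← Finset.sum_sub_distrib, Fintype.sum_eq_single s, Function.update_self]
  intro s' hs'
  rw [Function.update_of_ne hs', sub_self]

theorem productVertex_injective (hq : ∀ s, AffineIndependent ℝ (q s)) :
    Function.Injective (productVertex q) := by
  intro f g hfg
  funext s
  apply (hq s).injective
  funext i
  exact congrFun hfg ⟨s, i⟩

theorem setOf_block_mem_eq_convexHull :
    {x : ((s : Fin t) × Fin (m s)) → ℝ | ∀ s, block x s ∈ convexHull ℝ (Set.range (q s))} =
      convexHull ℝ (Set.range (productVertex q)) := by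
  let e := LinearEquiv.piCurry ℝ (fun (s : Fin t) (_ : Fin (m s)) => ℝ)
  have h1 : Set.range (productVertex q) =
      e.symm '' (Set.univ.pi fun s => Set.range (q s)) := by
    rw [← Set.range_piMap, ← Set.range_comp]
    rfl
  have h2 := LinearMap.image_convexHull e.symm.toLinearMap
    (Set.univ.pi fun s => Set.range (q s))
  simp only [LinearEquiv.coe_coe] at h2
  rw [h1, ← h2, convexHull_pi, LinearEquiv.image_symm_eq_preimage]
  ext x
  simp only [Set.mem_preimage, Set.mem_univ_pi]
  rfl

theorem exists_dotProduct_productVertex_eq (hq : ∀ s, AffineIndependent ℝ (q s))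
    (y : (s : Fin t) → Fin (m s + 1) → ℝ) :
    ∃ ω a, ∀ f, ω ⬝ᵥ productVertex q f = (∑ s, y s (f s)) + a := by
  choose ω a h using fun s => exists_dotProduct_vertex_eq (hq s) (y s)
  refine ⟨fun k => ω k.1 k.2, ∑ s, a s, fun f => ?_⟩
  rw [dotProduct_productVertex, ← Finset.sum_add_distrib]
  exact Finset.sum_congr rfl fun s _ => h s (f s)

/-- Products of faces of the simplices are faces of their product. -/
theorem exists_forall_dotProduct_productVertex_le_iff (hq : ∀ s, AffineIndependent ℝ (q s))
    (J : (s : Fin t) → Set (Fin (m s + 1))) (hJ : ∀ s, (J s).Nonempty) :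
    ∃ ω, ∀ f, (∀ g, ω ⬝ᵥ productVertex q g ≤ ω ⬝ᵥ productVertex q f) ↔ ∀ s, f s ∈ J s := by
  classical
  obtain ⟨ω, a, hω⟩ := exists_dotProduct_productVertex_eq hq fun s i => if i ∈ J s then 1 else 0
  choose g hg using hJ
  refine ⟨ω, fun f => ?_⟩
  simp only [hω, add_le_add_iff_right]
  constructor
  · intro h s
    by_contra hs
    refine (h g).not_gt (Finset.sum_lt_sum (fun s' _ => ?_) ⟨s, Finset.mem_univ s, ?_⟩)
    · rw [if_pos (hg s')]
      split_ifs <;> norm_num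
    · rw [if_pos (hg s), if_neg hs]
      exact one_pos
  · intro h g'
    refine Finset.sum_le_sum fun s _ => ?_
    rw [if_pos (h s)]
    split_ifs <;> norm_num

theorem productVertex_mem_extremePoints (hq : ∀ s, AffineIndependent ℝ (q s))
    (f : (s : Fin t) → Fin (m s + 1)) :
    productVertex q f ∈ (convexHull ℝ (Set.range (productVertex q))).extremePoints ℝ := by
  obtain ⟨ω, hω⟩ := exists_forall_dotProduct_productVertex_le_iff hq (fun s => {f s})
    fun s => Set.singleton_nonempty _
  refine mem_extremePoints_convexHull_range (w := ω) fun g => (hω g).trans ?_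
  simp only [Set.mem_singleton_iff, funext_iff]

theorem isEdge_productVertex_update (hq : ∀ s, AffineIndependent ℝ (q s))
    (f : (s : Fin t) → Fin (m s + 1)) {s : Fin t} {j : Fin (m s + 1)} (hj : f s ≠ j) :
    IsEdge (convexHull ℝ (Set.range (productVertex q))) (productVertex q f)
      (productVertex q (Function.update f s j)) := by
  obtain ⟨ω, hω⟩ := exists_forall_dotProduct_productVertex_le_iff hq
    -- These sets are singletons except at `s`, where there are two choices.
    (fun s' => {f s', Function.update f s j s'}) fun s' => Set.insert_nonempty _ _
  refine isEdge_convexHull_range (w := ω) ((productVertex_injective hq).ne fun h => hj ?_)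
    fun g => (hω g).trans ?_
  · have := congrFun h s
    rwa [Function.update_self] at this
  · simp only [Set.mem_insert_iff, Set.mem_singleton_iff]
    constructor
    · intro h
      have hne : ∀ s' ≠ s, g s' = f s' := fun s' hs' => by
        simpa [Function.update_of_ne hs'] using h s'
      rcases h s with h' | h'
      · refine Or.inl (funext fun s' => ?_)
        rcases eq_or_ne s' s with rfl | hs'
        exacts [h', hne s' hs']
      · refine Or.inr (funext fun s' => ?_)
        rcases eq_or_ne s' s with rfl | hs'
        · exact h'
        · rw [hne s' hs', Function.update_of_ne hs']
    · rintro (rfl | rfl) s'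
      exacts [Or.inl rfl, Or.inr rfl]

/-- Exchanging the `s`-th components of `f` and `g` preserves the sum of the two vertices, so their
midpoint lies on another segment of the polytope. The edge, being a face, contains the exchanged
vertices; each is then an endpoint of it, and the one that differs from `f` at `s` is `g`. -/
theorem exists_eq_update_of_isEdge (hq : ∀ s, AffineIndependent ℝ (q s))
    {f g : (s : Fin t) → Fin (m s + 1)}
    (h : IsEdge (convexHull ℝ (Set.range (productVertex q))) (productVertex q f)
      (productVertex q g)) : ∃ s j, f s ≠ j ∧ g = Function.update f s j := by
  have hfg : f ≠ g := fun hfg => h.1 (by rw [hfg])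
  obtain ⟨s, hs⟩ := Function.ne_iff.1 hfg
  refine ⟨s, g s, hs, ?_⟩
  have hsum : productVertex q f + productVertex q g =
      productVertex q (Function.update f s (g s)) +
        productVertex q (Function.update g s (f s)) := by
    funext ⟨s', i⟩
    simp only [Pi.add_apply, productVertex]
    rcases eq_or_ne s' s with rfl | hs'
    · rw [Function.update_self, Function.update_self, add_comm]
    · rw [Function.update_of_ne hs', Function.update_of_ne hs']
  have hmid : midpoint ℝ (productVertex q f) (productVertex q g) ∈
      openSegment ℝ (productVertex q (Function.update f s (g s)))
        (productVertex q (Function.update g s (f s))) := by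
    refine ⟨1 / 2, 1 / 2, by norm_num, by norm_num, by norm_num, ?_⟩
    rw [← smul_add, ← hsum, midpoint_eq_smul_add]
    norm_num
  have hmem : productVertex q (Function.update f s (g s)) ∈
      segment ℝ (productVertex q f) (productVertex q g) :=
    h.2.isExtreme.left_mem_of_mem_openSegment (subset_convexHull ℝ _ ⟨_, rfl⟩)
      (subset_convexHull ℝ _ ⟨_, rfl⟩) (midpoint_mem_segment _ _) hmid
  have hext : productVertex q (Function.update f s (g s)) ∈
      (segment ℝ (productVertex q f) (productVertex q g)).extremePoints ℝ := by
    rw [h.2.isExtreme.extremePoints_eq]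
    exact ⟨hmem, productVertex_mem_extremePoints hq _⟩
  rw [← convexHull_pair] at hext
  rcases extremePoints_convexHull_subset hext with h' | h'
  · have := congrFun (productVertex_injective hq h') s
    rw [Function.update_self] at this
    exact absurd this.symm hs
  · exact (productVertex_injective hq h').symm

theorem improvingNeighbors_product (hq : ∀ s, AffineIndependent ℝ (q s))
    {c : ((s : Fin t) × Fin (m s)) → ℝ} (hc : ∀ s, StrictMono fun i => block c s ⬝ᵥ q s i)
    (f : (s : Fin t) → Fin (m s + 1)) (v : ((s : Fin t) × Fin (m s)) → ℝ) :
    v ∈ improvingNeighbors (convexHull ℝ (Set.range (productVertex q))) c (productVertex q f) ↔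
      ∃ s j, f s < j ∧ productVertex q (Function.update f s j) = v := by
  constructor
  · rintro ⟨hv, hlt⟩
    obtain ⟨g, rfl⟩ := extremePoints_convexHull_subset hv.right_mem
    obtain ⟨s, j, hj, rfl⟩ := exists_eq_update_of_isEdge hq hv
    refine ⟨s, j, (hc s).lt_iff_lt.1 ?_, rfl⟩
    rw [← sub_pos, ← dotProduct_sub, dotProduct_productVertex_update] at hlt
    exact sub_pos.1 hlt
  · rintro ⟨s, j, hj, rfl⟩
    refine ⟨isEdge_productVertex_update hq f hj.ne, ?_⟩
    rw [← sub_pos, ← dotProduct_sub, dotProduct_productVertex_update]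
    exact sub_pos.2 (hc s hj)

end Product

/-! ### The product slope map and the pivot fan of a product of simplices -/

/-- The values of `w` can be perturbed to distinct ones, compatibly with their order. -/
theorem exists_injective_refinement {α : Type*} [Fintype α] (w : α → ℝ) :
    ∃ w₁ : α → ℝ, Function.Injective w₁ ∧ ∀ a b, w₁ a ≤ w₁ b → w a ≤ w b := by
  let e := Fintype.equivFin α
  let σ := Tuple.sort (w ∘ e.symm)
  have hmono : Monotone ((w ∘ e.symm) ∘ σ) := Tuple.monotone_sort (w ∘ e.symm)
  refine ⟨fun a => ((σ.symm (e a) : ℕ) : ℝ), fun a b hab => ?_, fun a b hab => ?_⟩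
  · exact e.injective (σ.symm.injective (Fin.ext (Nat.cast_injective hab)))
  · have : σ.symm (e a) ≤ σ.symm (e b) := Nat.cast_le.1 hab
    simpa using hmono this

section Product

variable {t : ℕ} {m : Fin t → ℕ}

/-- The cone with `w₀` in its relative interior, for the fan of the vectors of
`ℝ^(m 1) × ⋯ × ℝ^(m t)` that compares coordinates in distinct blocks, and records the positions of
the minima over all the intervals of each block. -/
def blockFanCone (w₀ : ((s : Fin t) × Fin (m s)) → ℝ) : Set (((s : Fin t) × Fin (m s)) → ℝ) :=
  {w | (∀ s i j, IsMinBetween (block w₀ s) i j → block w s j ≤ block w s i) ∧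
    ∀ k k' : (s : Fin t) × Fin (m s), k.1 ≠ k'.1 → w₀ k' ≤ w₀ k → w k' ≤ w k}

theorem mem_blockFanCone_of_le {w₀ w : ((s : Fin t) × Fin (m s)) → ℝ}
    (h : ∀ k k', w₀ k' ≤ w₀ k → w k' ≤ w k) : w ∈ blockFanCone w₀ :=
  ⟨fun s i j hij => h ⟨s, i⟩ ⟨s, j⟩ (hij i Set.left_mem_uIcc), fun k k' _ => h k k'⟩

variable {q : (s : Fin t) → Fin (m s + 1) → Fin (m s) → ℝ} {c : ((s : Fin t) × Fin (m s)) → ℝ}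

/-- The concatenation of the slope vectors of simplices with sorted vertices. -/
def productSlopes (q : (s : Fin t) → Fin (m s + 1) → Fin (m s) → ℝ)
    (c ω : ((s : Fin t) × Fin (m s)) → ℝ) : ((s : Fin t) × Fin (m s)) → ℝ :=
  fun k => slopeVector (fun i => block c k.1 ⬝ᵥ q k.1 i) (fun i => block ω k.1 ⬝ᵥ q k.1 i) k.2

theorem isSlopeVector_productSlopes (ω : ((s : Fin t) × Fin (m s)) → ℝ) (s : Fin t) :
    IsSlopeVector (fun i => block c s ⬝ᵥ q s i) (fun i => block ω s ⬝ᵥ q s i)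
      (block (productSlopes q c ω) s) :=
  isSlopeVector_slopeVector _ _

theorem isHomeomorph_productSlopes (hq : ∀ s, AffineIndependent ℝ (q s))
    (hc : ∀ s, StrictMono fun i => block c s ⬝ᵥ q s i) :
    IsHomeomorph (productSlopes q c) := by
  refine isHomeomorph_iff_exists_inverse.2 ⟨continuous_pi fun k => ?_, fun w k =>
    weightOfSlopes (hq k.1) (fun i => block c k.1 ⬝ᵥ q k.1 i) (block w k.1) k.2,
    fun ω => ?_, fun w => ?_, continuous_pi fun k => ?_⟩
  · refine (continuous_apply k.2).comp ((continuous_slopeVector _).comp ?_)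
    unfold block dotProduct
    fun_prop
  · funext k
    exact congrFun (weightOfSlopes_slopeVector (hq k.1) (hc k.1) (block ω k.1)) k.2
  · funext k
    exact congrFun (slopeVector_weightOfSlopes (hq k.1) (hc k.1) (block w k.1)) k.2
  · refine (continuous_apply k.2).comp ((continuous_weightOfSlopes _ _).comp ?_)
    unfold block
    fun_prop

theorem slopeOf_productVertex (ω : ((s : Fin t) × Fin (m s)) → ℝ)
    (f : (s : Fin t) → Fin (m s + 1)) (s : Fin t) (j : Fin (m s + 1)) :
    slopeOf c ω (productVertex q f) (productVertex q (Function.update f s j)) =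
      (block ω s ⬝ᵥ q s j - block ω s ⬝ᵥ q s (f s)) /
        (block c s ⬝ᵥ q s j - block c s ⬝ᵥ q s (f s)) := by
  rw [slopeOf, dotProduct_productVertex_update, dotProduct_productVertex_update]

/-- The improving neighbor obtained from `f` by replacing the `s`-th vertex by `j` is optimal iff
`j` is optimal in the `s`-th simplex, and the `s`-th slope is the largest one. -/
theorem mem_optimalNeighbors_product (hq : ∀ s, AffineIndependent ℝ (q s))
    (hc : ∀ s, StrictMono fun i => block c s ⬝ᵥ q s i) {ω : ((s : Fin t) × Fin (m s)) → ℝ}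
    {f : (s : Fin t) → Fin (m s + 1)} {s : Fin t} {i : Fin (m s)} {j : Fin (m s + 1)}
    (hi : f s = i.castSucc) (hj : i.castSucc < j) :
    productVertex q (Function.update f s j) ∈
        optimalNeighbors (convexHull ℝ (Set.range (productVertex q))) c ω (productVertex q f) ↔
      block ω s ⬝ᵥ q s j - block ω s ⬝ᵥ q s i.castSucc =
        productSlopes q c ω ⟨s, i⟩ * (block c s ⬝ᵥ q s j - block c s ⬝ᵥ q s i.castSucc) ∧
      ∀ s' i', f s' = Fin.castSucc i' →
        productSlopes q c ω ⟨s', i'⟩ ≤ productSlopes q c ω ⟨s, i⟩ := by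
  have hpos : 0 < block c s ⬝ᵥ q s j - block c s ⬝ᵥ q s i.castSucc := sub_pos.2 (hc s hj)
  rw [← div_eq_iff hpos.ne']
  have hmem : ∀ (s') (j' : Fin (m s' + 1)), f s' < j' →
      productVertex q (Function.update f s' j') ∈
        improvingNeighbors (convexHull ℝ (Set.range (productVertex q))) c (productVertex q f) :=
    fun s' j' h => (improvingNeighbors_product hq hc f _).2 ⟨s', j', h, rfl⟩
  constructor
  · rintro ⟨-, hmax⟩
    have key : ∀ s' i', f s' = Fin.castSucc i' → productSlopes q c ω ⟨s', i'⟩ ≤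
        (block ω s ⬝ᵥ q s j - block ω s ⬝ᵥ q s i.castSucc) /
          (block c s ⬝ᵥ q s j - block c s ⬝ᵥ q s i.castSucc) := by
      intro s' i' hi'
      obtain ⟨j', hj', heq⟩ := (isSlopeVector_productSlopes (q := q) (c := c) ω s' i').1
      have := hmax _ (hmem s' j' (hi' ▸ hj'))
      rw [slopeOf_productVertex, slopeOf_productVertex, hi, hi'] at this
      exact heq.symm.le.trans this
    have heq := le_antisymm
      ((isSlopeVector_productSlopes (q := q) (c := c) ω s i).2 ⟨j, hj, rfl⟩) (key s i hi)
    exact ⟨heq, fun s' i' hi' => (key s' i' hi').trans heq.le⟩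
  · rintro ⟨heq, hle⟩
    refine ⟨hmem s j (hi ▸ hj), fun v hv => ?_⟩
    obtain ⟨s', j', hj', rfl⟩ := (improvingNeighbors_product hq hc f _).1 hv
    obtain ⟨i', hi'⟩ := Fin.exists_castSucc_eq.2 (Fin.ne_last_of_lt hj')
    rw [slopeOf_productVertex, slopeOf_productVertex, hi, heq, ← hi']
    exact ((isSlopeVector_productSlopes (q := q) (c := c) ω s' i').2
      ⟨j', hi' ▸ hj', rfl⟩).trans (hle s' i' hi'.symm)

/-- The comparisons needed are isolated by special vertices: components at the last vertex of their
simplex have no improving move and drop out of the competition. -/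
theorem mem_pivotCone_product (hq : ∀ s, AffineIndependent ℝ (q s))
    (hc : ∀ s, StrictMono fun i => block c s ⬝ᵥ q s i) {ω₀ ω : ((s : Fin t) × Fin (m s)) → ℝ} :
    ω ∈ pivotCone (convexHull ℝ (Set.range (productVertex q))) c ω₀ ↔
      productSlopes q c ω ∈ blockFanCone (productSlopes q c ω₀) := by
  have hfan : (∀ s i j, IsMinBetween (block (productSlopes q c ω₀) s) i j →
      block (productSlopes q c ω) s j ≤ block (productSlopes q c ω) s i) ↔
      ∀ (s) (i : Fin (m s)) (j : Fin (m s + 1)), i.castSucc < j →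
        block ω₀ s ⬝ᵥ q s j - block ω₀ s ⬝ᵥ q s i.castSucc = productSlopes q c ω₀ ⟨s, i⟩ *
          (block c s ⬝ᵥ q s j - block c s ⬝ᵥ q s i.castSucc) →
        block ω s ⬝ᵥ q s j - block ω s ⬝ᵥ q s i.castSucc = productSlopes q c ω ⟨s, i⟩ *
          (block c s ⬝ᵥ q s j - block c s ⬝ᵥ q s i.castSucc) :=
    forall_congr' fun s => ((isSlopeVector_productSlopes ω₀ s).forall_eq_iff
      (isSlopeVector_productSlopes ω s) (hc s)).symm
  rw [blockFanCone, Set.mem_ofPred_eq, hfan]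
  constructor
  · intro h
    refine ⟨fun s i j hj heq => ?_, ?_⟩
    -- Only the `s`-th component can move, so optimality is that of the `s`-th simplex.
    · let f : (s : Fin t) → Fin (m s + 1) :=
        Function.update (fun s => Fin.last (m s)) s i.castSucc
      have hi : f s = i.castSucc := Function.update_self ..
      have hopt := (mem_optimalNeighbors_product hq hc (ω := ω₀) hi hj).2 ⟨heq, fun s' i' hi' => by
        rcases eq_or_ne s' s with rfl | hs'
        · rw [Fin.castSucc_injective _ (hi'.symm.trans hi)]
        · simp only [f] at hi'
          rw [Function.update_of_ne hs'] at hi'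
          exact absurd hi'.symm (Fin.castSucc_lt_last i').ne⟩
      exact ((mem_optimalNeighbors_product hq hc hi hj).1
        (h _ (productVertex_mem_extremePoints hq f) hopt)).1
    · rintro ⟨s, i⟩ ⟨s', i'⟩ hs hle
      -- Only two components can move, so optimality compares their two slopes.
      let f : (s : Fin t) → Fin (m s + 1) :=
        Function.update (Function.update (fun s => Fin.last (m s)) s i.castSucc) s' i'.castSucc
      have hi' : f s' = i'.castSucc := Function.update_self ..
      have hi : f s = i.castSucc := by
        simp only [f]
        rw [Function.update_of_ne hs, Function.update_self]
      obtain ⟨j, hj, heq⟩ := (isSlopeVector_productSlopes (q := q) (c := c) ω₀ s).exists_eq (hc s) i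
      have hopt := (mem_optimalNeighbors_product hq hc (ω := ω₀) hi hj).2
        ⟨heq, fun r k hk => by
          rcases eq_or_ne r s' with rfl | hr'
          · rwa [Fin.castSucc_injective _ (hk.symm.trans hi')]
          rcases eq_or_ne r s with rfl | hr
          · rw [Fin.castSucc_injective _ (hk.symm.trans hi)]
          · simp only [f] at hk
            rw [Function.update_of_ne hr', Function.update_of_ne hr] at hk
            exact absurd hk.symm (Fin.castSucc_lt_last k).ne⟩
      exact ((mem_optimalNeighbors_product hq hc hi hj).1
        (h _ (productVertex_mem_extremePoints hq f) hopt)).2 s' i' hi'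
  · rintro ⟨h1, h2⟩ u hu v hv
    obtain ⟨f, rfl⟩ := extremePoints_convexHull_subset hu
    obtain ⟨s, j, hj, rfl⟩ := (improvingNeighbors_product hq hc f v).1 hv.1
    obtain ⟨i, hi⟩ := Fin.exists_castSucc_eq.2 (Fin.ne_last_of_lt hj)
    rw [← hi] at hj
    obtain ⟨h3, h4⟩ := (mem_optimalNeighbors_product hq hc hi.symm hj).1 hv
    refine (mem_optimalNeighbors_product hq hc hi.symm hj).2
      ⟨h1 s i j hj h3, fun s' i' hi' => ?_⟩
    rcases eq_or_ne s' s with rfl | hs'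
    · rw [Fin.castSucc_injective _ (hi'.symm.trans hi.symm)]
    · exact h2 ⟨s, i⟩ ⟨s', i'⟩ hs'.symm (h4 s' i' hi')

/-- Two optimal moves have equal slopes, so injectivity puts them in the same factor at the same
vertex; there the target is unique. -/
theorem optimalNeighbors_product_subsingleton (hq : ∀ s, AffineIndependent ℝ (q s))
    (hc : ∀ s, StrictMono fun i => block c s ⬝ᵥ q s i) {ω : ((s : Fin t) × Fin (m s)) → ℝ}
    (hω : Function.Injective (productSlopes q c ω)) (f : (s : Fin t) → Fin (m s + 1)) :
    (optimalNeighbors (convexHull ℝ (Set.range (productVertex q))) c ω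
      (productVertex q f)).Subsingleton := by
  intro v hv v' hv'
  obtain ⟨s, j, hj, rfl⟩ := (improvingNeighbors_product hq hc f v).1 hv.1
  obtain ⟨s', j', hj', rfl⟩ := (improvingNeighbors_product hq hc f v').1 hv'.1
  obtain ⟨i, hi⟩ := Fin.exists_castSucc_eq.2 (Fin.ne_last_of_lt hj)
  obtain ⟨i', hi'⟩ := Fin.exists_castSucc_eq.2 (Fin.ne_last_of_lt hj')
  rw [← hi] at hj
  rw [← hi'] at hj'
  obtain ⟨h1, h2⟩ := (mem_optimalNeighbors_product hq hc hi.symm hj).1 hv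
  obtain ⟨h3, h4⟩ := (mem_optimalNeighbors_product hq hc hi'.symm hj').1 hv'
  have heq := hω (le_antisymm (h4 s i hi.symm) (h2 s' i' hi'.symm))
  obtain ⟨rfl, hii⟩ := Sigma.mk.inj_iff.1 heq
  obtain rfl := eq_of_heq hii
  have hinj : Function.Injective (block (productSlopes q c ω) s) := fun a b hab =>
    eq_of_heq (Sigma.mk.inj_iff.1 (hω hab)).2
  rw [(isSlopeVector_productSlopes ω s).unique (hc s) hinj i hj hj' h1 h3]

/-- Generic weights are obtained by perturbing the slopes to distinct values and pulling back along
the surjective slope map. -/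
theorem pivotFan_product (hq : ∀ s, AffineIndependent ℝ (q s))
    (hc : ∀ s, StrictMono fun i => block c s ⬝ᵥ q s i) :
    pivotFan (convexHull ℝ (Set.range (productVertex q))) c =
      Set.range (pivotCone (convexHull ℝ (Set.range (productVertex q))) c) := by
  refine pivotFan_eq_range ((Set.finite_range _).subset extremePoints_convexHull_subset)
    (fun u _ => improvingNeighbors_subset_extremePoints _ c u) fun ω₀ => ?_
  obtain ⟨w₁, hinj, hle⟩ := exists_injective_refinement (productSlopes q c ω₀)
  obtain ⟨ω₁, rfl⟩ := (isHomeomorph_productSlopes hq hc).surjective w₁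
  refine ⟨ω₁, (mem_pivotCone_product hq hc).2 (mem_blockFanCone_of_le fun k k' => hle k' k),
    fun u hu => ?_⟩
  obtain ⟨f, rfl⟩ := extremePoints_convexHull_subset hu
  exact optimalNeighbors_product_subsingleton hq hc hinj f

/-- One optimal target per coordinate is fixed for `ω₀`; it stays optimal throughout the cone, where
the maximal slope is thus a fixed linear functional. -/
theorem exists_linearMap_eqOn_pivotCone (hq : ∀ s, AffineIndependent ℝ (q s))
    (hc : ∀ s, StrictMono fun i => block c s ⬝ᵥ q s i) (ω₀ : ((s : Fin t) × Fin (m s)) → ℝ) :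
    ∃ L : (((s : Fin t) × Fin (m s)) → ℝ) →ₗ[ℝ] ((s : Fin t) × Fin (m s)) → ℝ,
      Set.EqOn (productSlopes q c) L
        (pivotCone (convexHull ℝ (Set.range (productVertex q))) c ω₀) := by
  choose j hj heq using fun k : (s : Fin t) × Fin (m s) =>
    (isSlopeVector_productSlopes (q := q) (c := c) ω₀ k.1).exists_eq (hc k.1) k.2
  let f : (s : Fin t) → Fin (m s + 1) := fun s => Fin.last (m s)
  refine ⟨LinearMap.pi fun k => (slopeFunctional c
    (productVertex q (Function.update f k.1 k.2.castSucc)) (productVertex q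
      (Function.update (Function.update f k.1 k.2.castSucc) k.1 (j k)))).toLinearMap,
    fun ω hω => funext fun k => ?_⟩
  have hfan := ((isSlopeVector_productSlopes ω₀ k.1).forall_eq_iff
    (isSlopeVector_productSlopes ω k.1) (hc k.1)).2
      (((mem_pivotCone_product hq hc).1 hω).1 k.1) k.2 (j k) (hj k) (heq k)
  simp only [LinearMap.pi_apply, ContinuousLinearMap.coe_coe, slopeFunctional_apply]
  rw [slopeOf_productVertex, Function.update_self]
  have hpos : 0 < block c k.1 ⬝ᵥ q k.1 (j k) - block c k.1 ⬝ᵥ q k.1 k.2.castSucc :=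
    sub_pos.2 (hc k.1 (hj k))
  exact ((div_eq_iff hpos.ne').2 hfan).symm

end Product

/-! ### The block fan and the normal fans of the four polytopes. -/

section Main

variable {t : ℕ} {m : Fin t → ℕ}

/-- Every edge of a factor is parallel to an edge of the product, so genericity passes to each
simplex. -/
theorem strictMono_sort_of_isGenericDirection
    {Δ : (s : Fin t) → Affine.Simplex ℝ (Fin (m s) → ℝ) (m s)}
    {c : ((s : Fin t) × Fin (m s)) → ℝ} (hc : IsGenericDirection (simplexProduct Δ) c)
    (s : Fin t) : StrictMono fun i => block c s ⬝ᵥ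
      (Δ s).points (Tuple.sort (fun j => block c s ⬝ᵥ (Δ s).points j) i) := by
  have hinj : Function.Injective fun i => block c s ⬝ᵥ (Δ s).points i := by
    intro i j hij
    by_contra hne
    have hP : simplexProduct Δ =
        convexHull ℝ (Set.range (productVertex fun s => (Δ s).points)) :=
      setOf_block_mem_eq_convexHull
    rw [hP] at hc
    let f : (s : Fin t) → Fin (m s + 1) := Function.update (fun _ => 0) s i
    have hf : f s = i := Function.update_self ..
    refine hc _ _ (isEdge_productVertex_update (fun s => (Δ s).independent) f
      (hf.trans_ne hne)) ?_
    rw [eq_comm, ← sub_eq_zero, ← dotProduct_sub, dotProduct_productVertex_update, hf]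
    exact sub_eq_zero.2 hij.symm
  exact (Tuple.monotone_sort _).strictMono_of_injective (hinj.comp (Equiv.injective _))

/-- If the normal fan of `Q` is the fan given by the cones `blockFanCone`, the product slope map is
a piecewise linear isomorphism from the pivot fan of a product of simplices to it. -/
theorem isPiecewiseLinearFanIso_productSlopeMap {N : ℕ} (h : ∑ s, m s = N)
    {Δ : (s : Fin t) → Affine.Simplex ℝ (Fin (m s) → ℝ) (m s)}
    {c : ((s : Fin t) × Fin (m s)) → ℝ} (hc : IsGenericDirection (simplexProduct Δ) c)
    {Q : Set (Fin N → ℝ)} (hQ : HasMaxFaces Q) (hfan : ∀ w₀ w : Fin N → ℝ,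
      w ∈ faceCone Q w₀ ↔ w ∘ (concatIndex h).symm ∈ blockFanCone (w₀ ∘ (concatIndex h).symm)) :
    IsPiecewiseLinearFanIso (productSlopeMap h Δ c) (pivotFan (simplexProduct Δ) c)
      (normalFan Q) := by
  let σ : (s : Fin t) → Equiv.Perm (Fin (m s + 1)) := fun s =>
    Tuple.sort fun j => block c s ⬝ᵥ (Δ s).points j
  let q : (s : Fin t) → Fin (m s + 1) → Fin (m s) → ℝ := fun s => (Δ s).points ∘ σ s
  have hq : ∀ s, AffineIndependent ℝ (q s) := fun s =>
    (Δ s).independent.comp_embedding (σ s).toEmbedding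
  have hmono : ∀ s, StrictMono fun i => block c s ⬝ᵥ q s i :=
    strictMono_sort_of_isGenericDirection hc
  have hP : simplexProduct Δ = convexHull ℝ (Set.range (productVertex q)) := by
    rw [← setOf_block_mem_eq_convexHull, simplexProduct]
    simp only [q, (σ _).surjective.range_comp]
  have hΘ : ∀ ω, productSlopeMap h Δ c ω = productSlopes q c ω ∘ concatIndex h := fun ω =>
    funext fun k => congrFun (slopeMap_eq (Δ (concatIndex h k).1).independent
      (hmono (concatIndex h k).1) (block ω (concatIndex h k).1)) (concatIndex h k).2
  have hhomeo : IsHomeomorph (productSlopeMap h Δ c) := by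
    have hcomp : IsHomeomorph fun x : ((s : Fin t) × Fin (m s)) → ℝ => x ∘ concatIndex h :=
      isHomeomorph_iff_exists_inverse.2 ⟨continuous_pi fun k => continuous_apply _,
        fun x => x ∘ (concatIndex h).symm, fun x => by simp [Function.comp_assoc],
        fun x => by simp [Function.comp_assoc], continuous_pi fun k => continuous_apply _⟩
    rw [funext hΘ]
    exact hcomp.comp (isHomeomorph_productSlopes hq hmono)
  have himage : ∀ ω₀, productSlopeMap h Δ c '' pivotCone (simplexProduct Δ) c ω₀ =
      faceCone Q (productSlopeMap h Δ c ω₀) := by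
    intro ω₀
    have hiff : ∀ ω, ω ∈ pivotCone (simplexProduct Δ) c ω₀ ↔
        productSlopeMap h Δ c ω ∈ faceCone Q (productSlopeMap h Δ c ω₀) := by
      intro ω
      rw [hP, mem_pivotCone_product hq hmono, hfan, hΘ, hΘ, Function.comp_assoc,
        Function.comp_assoc, Equiv.self_comp_symm, Function.comp_id, Function.comp_id]
    ext w
    obtain ⟨ω, rfl⟩ := hhomeo.surjective w
    rw [hhomeo.injective.mem_set_image, hiff]
  have hpivot : pivotFan (simplexProduct Δ) c = Set.range (pivotCone (simplexProduct Δ) c) := by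
    rw [hP]
    exact pivotFan_product hq hmono
  refine ⟨hhomeo, fun C hC => ?_, ?_⟩
  · rw [hpivot] at hC
    obtain ⟨ω₀, rfl⟩ := hC
    rw [hP]
    obtain ⟨L, hL⟩ := exists_linearMap_eqOn_pivotCone hq hmono ω₀
    refine ⟨LinearMap.funLeft ℝ ℝ (concatIndex h) ∘ₗ L, fun ω hω => ?_⟩
    rw [hΘ, hL hω]
    rfl
  · rw [hpivot, normalFan_eq_range hQ, ← Set.range_comp,
      ← hhomeo.surjective.range_comp (faceCone Q)]
    exact congrArg Set.range (funext himage)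

theorem mem_blockFanCone_comp {N : ℕ} (e : Fin N ≃ (s : Fin t) × Fin (m s)) {w₀ w : Fin N → ℝ} :
    w ∘ e.symm ∈ blockFanCone (w₀ ∘ e.symm) ↔
      (∀ s i j, IsMinBetween (fun i => w₀ (e.symm ⟨s, i⟩)) i j →
        w (e.symm ⟨s, j⟩) ≤ w (e.symm ⟨s, i⟩)) ∧
      ∀ a b, (e a).1 ≠ (e b).1 → w₀ b ≤ w₀ a → w b ≤ w a := by
  refine and_congr Iff.rfl ⟨fun h a b => ?_, fun h k k' => ?_⟩
  · simpa using h (e a) (e b)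
  · simpa using h (e.symm k) (e.symm k')

theorem coe_concatIndex_symm {N : ℕ} (h : ∑ s, m s = N) (k : (s : Fin t) × Fin (m s)) :
    ((concatIndex h).symm k : ℕ) =
      ∑ i : Fin k.1, m (Fin.castLE k.1.2.le i) + (k.2 : ℕ) := by
  rw [← finSigmaFinEquiv_apply]
  rfl

/-- With singleton blocks, any two distinct coordinates are in distinct blocks and get compared. -/
theorem mem_faceCone_permutahedron_iff_block (hm : ∀ s, m s = 1) (h : ∑ s, m s = t)
    (w₀ w : Fin t → ℝ) : w ∈ faceCone (permutahedron t) w₀ ↔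
      w ∘ (concatIndex h).symm ∈ blockFanCone (w₀ ∘ (concatIndex h).symm) := by
  rw [mem_faceCone_permutahedron]
  refine ⟨fun hw => mem_blockFanCone_of_le fun k k' => hw _ _, fun hw a b hab => ?_⟩
  rw [mem_blockFanCone_comp] at hw
  by_cases hne : (concatIndex h a).1 = (concatIndex h b).1
  · have : concatIndex h a = concatIndex h b := by
      generalize concatIndex h a = x at hne
      generalize concatIndex h b = y at hne
      obtain ⟨s, i⟩ := x
      obtain ⟨s', i'⟩ := y
      obtain rfl : s = s' := hne
      have := i.2
      have := i'.2
      have := hm s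
      congr 1
      exact Fin.ext (by omega)
    rw [(concatIndex h).injective this]
  · exact hw.2 a b hne hab

theorem mem_faceCone_associahedron_iff_block {m : Fin 1 → ℕ} (h : ∑ s, m s = m 0)
    (w₀ w : Fin (m 0) → ℝ) : w ∈ faceCone (associahedron (m 0)) w₀ ↔
      w ∘ (concatIndex h).symm ∈ blockFanCone (w₀ ∘ (concatIndex h).symm) := by
  have he : ∀ i, (concatIndex h).symm ⟨0, i⟩ = i := fun i =>
    Fin.ext (by simp [coe_concatIndex_symm])
  rw [mem_faceCone_associahedron, mem_blockFanCone_comp]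
  simp only [Unique.forall_iff, Fin.default_eq_zero, he]
  exact ⟨fun hw => ⟨hw, fun a b hne => absurd (Subsingleton.elim _ _) hne⟩, fun hw => hw.1⟩

theorem mem_faceCone_constrainahedron_iff_block {m : Fin 2 → ℕ} (h : ∑ s, m s = m 0 + m 1)
    (w₀ w : Fin (m 0 + m 1) → ℝ) : w ∈ faceCone (constrainahedron (m 0) (m 1)) w₀ ↔
      w ∘ (concatIndex h).symm ∈ blockFanCone (w₀ ∘ (concatIndex h).symm) := by
  have he₀ : ∀ i, (concatIndex h).symm ⟨0, i⟩ = Fin.castAdd (m 1) i := fun i =>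
    Fin.ext (by simp [coe_concatIndex_symm])
  have he₁ : ∀ j, (concatIndex h).symm ⟨1, j⟩ = Fin.natAdd (m 0) j := fun j =>
    Fin.ext (by simp [coe_concatIndex_symm])
  have hf₀ : ∀ i, (concatIndex h (Fin.castAdd (m 1) i)).1 = 0 := fun i => by
    rw [← he₀, Equiv.apply_symm_apply]
  have hf₁ : ∀ j, (concatIndex h (Fin.natAdd (m 0) j)).1 = 1 := fun j => by
    rw [← he₁, Equiv.apply_symm_apply]
  rw [constrainahedron, mem_faceCone_shuffle (hasMaxFaces_associahedron _)
    (hasMaxFaces_associahedron _), mem_faceCone_associahedron, mem_faceCone_associahedron,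
    mem_blockFanCone_comp]
  simp only [Fin.forall_fin_two, he₀, he₁]
  refine and_congr Iff.rfl ⟨fun hw a b hne => ?_, fun hw i j => ⟨hw _ _ ?_, hw _ _ ?_⟩⟩
  · induction a using Fin.addCases with
    | left i =>
      induction b using Fin.addCases with
      | left i' => exact absurd ((hf₀ i).trans (hf₀ i').symm) hne
      | right j => exact (hw i j).1
    | right j =>
      induction b using Fin.addCases with
      | left i => exact (hw i j).2
      | right j' => exact absurd ((hf₁ j).trans (hf₁ j').symm) hne
  · rw [hf₀, hf₁]
    exact zero_ne_one
  · rw [hf₀, hf₁]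
    exact one_ne_zero

/-- The first `n` coordinates are singleton blocks. Comparisons among them give the permutahedron,
those with the last block the shuffle segments, and interval minima in the last block the
associahedron. -/
theorem mem_faceCone_multiplihedron_iff_block {n : ℕ} {m : Fin (n + 1) → ℕ}
    (hm : ∀ s, s ≠ Fin.last n → m s = 1) (h : ∑ s, m s = n + m (Fin.last n))
    (w₀ w : Fin (n + m (Fin.last n)) → ℝ) :
    w ∈ faceCone (multiplihedron n (m (Fin.last n))) w₀ ↔
      w ∘ (concatIndex h).symm ∈ blockFanCone (w₀ ∘ (concatIndex h).symm) := by
  have he : ∀ j, (concatIndex h).symm ⟨Fin.last n, j⟩ = Fin.natAdd n j := by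
    intro j
    refine Fin.ext ?_
    rw [coe_concatIndex_symm, Fin.val_natAdd, add_left_inj]
    -- The last block is preceded by `n` blocks of size one, so its offset is `n`.
    rw [Finset.sum_congr rfl fun i _ => hm (Fin.castLE _ i) (Fin.ne_of_lt i.2)]
    simp
  have hf : ∀ j, (concatIndex h (Fin.natAdd n j)).1 = Fin.last n := fun j => by
    rw [← he, Equiv.apply_symm_apply]
  have hf' : ∀ i, (concatIndex h (Fin.castAdd _ i)).1 ≠ Fin.last n := by
    intro i hi
    obtain ⟨j, hj⟩ : ∃ j, concatIndex h (Fin.castAdd _ i) = ⟨Fin.last n, j⟩ := by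
      generalize concatIndex h (Fin.castAdd _ i) = x at hi
      obtain ⟨s, j⟩ := x
      obtain rfl : s = Fin.last n := hi
      exact ⟨j, rfl⟩
    rw [← Equiv.eq_symm_apply, he] at hj
    have := congrArg Fin.val hj
    simp only [Fin.val_castAdd, Fin.val_natAdd] at this
    have := i.2
    omega
  have hsub : ∀ s, s ≠ Fin.last n → ∀ i j : Fin (m s), i = j := fun s hs i j => by
    have := i.2
    have := j.2
    have := hm s hs
    exact Fin.ext (by omega)
  have hinj : ∀ i i', (concatIndex h (Fin.castAdd _ i)).1 = (concatIndex h (Fin.castAdd _ i')).1 →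
      i = i' := by
    intro i i' hii
    have hne := hf' i
    refine Fin.castAdd_injective _ _ ((concatIndex h).injective ?_)
    generalize concatIndex h (Fin.castAdd _ i) = x at hii hne
    generalize concatIndex h (Fin.castAdd _ i') = y at hii
    obtain ⟨s, j⟩ := x
    obtain ⟨s', j'⟩ := y
    obtain rfl : s = s' := hii
    rw [hsub s hne j j']
  rw [multiplihedron, mem_faceCone_shuffle (hasMaxFaces_permutahedron _)
    (hasMaxFaces_associahedron _), mem_faceCone_permutahedron, mem_faceCone_associahedron,
    mem_blockFanCone_comp]
  constructor
  · rintro ⟨⟨h1, h2⟩, h3⟩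
    refine ⟨fun s i j hij => ?_, fun a b hne => ?_⟩
    · rcases eq_or_ne s (Fin.last n) with rfl | hs
      · simp only [he] at hij ⊢
        exact h2 i j hij
      · rw [hsub s hs i j]
    · induction a using Fin.addCases with
      | left i =>
        induction b using Fin.addCases with
        | left i' => exact h1 i i'
        | right j => exact (h3 i j).1
      | right j =>
        induction b using Fin.addCases with
        | left i => exact (h3 i j).2
        | right j' => exact absurd ((hf j).trans (hf j').symm) hne
  · rintro ⟨h1, h2⟩
    refine ⟨⟨fun i i' hii => ?_, fun a b hab => ?_⟩, fun i j => ⟨h2 _ _ ?_, h2 _ _ ?_⟩⟩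
    · by_cases hne : (concatIndex h (Fin.castAdd _ i)).1 = (concatIndex h (Fin.castAdd _ i')).1
      · rw [hinj i i' hne]
      · exact h2 _ _ hne hii
    · have := h1 (Fin.last n) a b
      simp only [he] at this
      exact this hab
    · rw [hf]
      exact hf' i
    · rw [hf]
      exact (hf' i).symm

end Main

end

theorem mainTheorem3 {t : ℕ} (ht : 0 < t) {m : Fin t → ℕ} (hm : ∀ s, 1 ≤ m s)
    (Δ : (s : Fin t) → Affine.Simplex ℝ (Fin (m s) → ℝ) (m s))
    (c : ((s : Fin t) × Fin (m s)) → ℝ) (hc : IsGenericDirection (simplexProduct Δ) c) :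
    ((∀ s, m s = 1) →
      ∃ h : ∑ s, m s = t,
        IsPiecewiseLinearFanIso (productSlopeMap h Δ c) (pivotFan (simplexProduct Δ) c)
          (normalFan (permutahedron t))) ∧
    (t = 1 →
      ∃ h : ∑ s, m s = m ⟨0, ht⟩,
        IsPiecewiseLinearFanIso (productSlopeMap h Δ c) (pivotFan (simplexProduct Δ) c)
          (normalFan (associahedron (m ⟨0, ht⟩)))) ∧
    (∀ ht2 : t = 2,
      ∃ h : ∑ s, m s = m ⟨0, ht⟩ + m ⟨1, by omega⟩,
        IsPiecewiseLinearFanIso (productSlopeMap h Δ c) (pivotFan (simplexProduct Δ) c)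
          (normalFan (constrainahedron (m ⟨0, ht⟩) (m ⟨1, by omega⟩)))) ∧
    ((∀ s : Fin t, (s : ℕ) < t - 1 → m s = 1) →
      ∃ h : ∑ s, m s = (t - 1) + m ⟨t - 1, by omega⟩,
        IsPiecewiseLinearFanIso (productSlopeMap h Δ c) (pivotFan (simplexProduct Δ) c)
          (normalFan (multiplihedron (t - 1) (m ⟨t - 1, by omega⟩)))) := by
  refine ⟨fun h1 => ?_, ?_, ?_, ?_⟩
  · have h : ∑ s, m s = t := by simp [h1]
    exact ⟨h, isPiecewiseLinearFanIso_productSlopeMap h hc (hasMaxFaces_permutahedron t)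
      (mem_faceCone_permutahedron_iff_block h1 h)⟩
  · rintro rfl
    have h : ∑ s, m s = m 0 := Fin.sum_univ_one m
    exact ⟨h, isPiecewiseLinearFanIso_productSlopeMap h hc (hasMaxFaces_associahedron _)
      (mem_faceCone_associahedron_iff_block h)⟩
  · rintro rfl
    have h : ∑ s, m s = m 0 + m 1 := Fin.sum_univ_two m
    exact ⟨h, isPiecewiseLinearFanIso_productSlopeMap h hc
      (hasMaxFaces_shuffle (hasMaxFaces_associahedron _) (hasMaxFaces_associahedron _))
      (mem_faceCone_constrainahedron_iff_block h)⟩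
  · intro h1
    obtain ⟨n, rfl⟩ : ∃ n, t = n + 1 := ⟨t - 1, by omega⟩
    have hlast : ∀ s, s ≠ Fin.last n → m s = 1 := fun s hs => h1 s (by
      have := Fin.val_lt_last hs
      simpa using this)
    have h : ∑ s, m s = n + m (Fin.last n) := by
      rw [Fin.sum_univ_castSucc, Finset.sum_congr rfl fun i _ =>
        hlast i.castSucc (Fin.castSucc_lt_last i).ne]
      simp
    exact ⟨h, isPiecewiseLinearFanIso_productSlopeMap h hc
      (hasMaxFaces_shuffle (hasMaxFaces_permutahedron _) (hasMaxFaces_associahedron _))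
      (mem_faceCone_multiplihedron_iff_block hlast h)⟩
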